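/- Let $\Delta\ge 3$, $0\le c\le \Delta-2$ and $\kappa=\Delta+c$. Let $V$ be a finite vertex set. A legal insertion sequence of length $m$ starts from the empty graph on $V$ and inserts edges $e_1,\dots,e_m$ one at a time, each joining two different trees of the current forest, so that all degrees are always at most $\Delta$. The sequence is fixed in advance, independently of the random choices of the algorithm. The algorithm DistMaint maintains a random edge-coloring with colors $[\kappa]$ as follows. Write $A(x)$ for the set of colors not currently used on edges at $x$, and $|E(T)|$ for the number of edges of a tree $T$. To insert an edge between $u$ and $v$, lying in the trees $T_u$ and $T_v$: 1. Name the endpoints so that $\deg(v)\le\deg(u)$ if $|E(T_u)|\le\Delta$ and $|E(T_v)|\le\Delta$, and so that $|E(T_v)|\le|E(T_u)|$ otherwise (degrees and sizes are those before the insertion; ties are broken arbitrarily, but independently of the coloring). Root $T_v$ at $v$ and make $u$ the parent of $v$. 2. Color $uv$ with a uniformly random color $\beta\in A(u)$. If no child edge of $v$ has color $\beta$, stop. Otherwise let $vw$ be the child edge of color $\beta$, choose $\alpha\in A(v)$ uniformly at random, recolor $vw$ to $\alpha$, and call $\mathrm{Fix}(w,\beta,\alpha)$. 3. $\mathrm{Fix}(x,\alpha,\beta)$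 (the parent edge of $x$ changed its color from $\alpha$ to $\beta$): if no child edge of $x$ has color $\beta$, stop. Otherwise recolor the child edge $xy$ of color $\beta$ to $\alpha$ and call $\mathrm{Fix}(y,\beta,\alpha)$. The recourse of an insertion is the number of previously colored edges whose color changes (the first coloring of the new edge does not count). The expected amortized recourse of a sequence of length $m$ is the expectation of its total recourse, divided by $m$. **Theorem.** After every insertion of a legal insertion sequence, the coloring maintained by DistMaint is uniformly distributed over all proper edge-colorings of the current forest with colors $[\kappa]$, and in the incremental model DistMaint has expected amortized recourse $\Theta(1/\Delta)$. That is, there are absolute constants $C_1,C_2>0$ such that for all $\Delta\ge 3$, $0\le c\le\Delta-2$ and all finite $V$: * for every legal insertion sequence and every way of breaking ties, the expected amortized recourse is at most $C_2/\Delta$; * for every $m$ with $3\le m\le |V|-1$ there is a legal insertion sequence of length $m$ for which, whatever the way of breaking ties, the expected amortized recourse is at least $C_1/\Delta$. -/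

import Mathlib

open scoped ENNReal

namespace DistMaint

variable {V : Type*} {κ : ℕ}

/-! ### Incremental forests -/

/-- The graph after the first `t` insertions of the sequence `e`, starting from the empty graph. -/
def forestAt (e : ℕ → V × V) : ℕ → SimpleGraph V
  | 0 => ⊥
  | t + 1 => forestAt e t ⊔ SimpleGraph.edge (e t).1 (e t).2

/-- The first `m` entries of `e` are a legal incremental sequence: every insertion joins two
different trees of the current forest (so the graph always stays a forest), and all degrees are at
most `Δ` at all times. -/
def IsInsertionSequence (Δ : ℕ) (e : ℕ → V × V) (m : ℕ) : Prop :=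
  (∀ t < m, ¬ (forestAt e t).Reachable (e t).1 (e t).2) ∧
    ∀ t ≤ m, ∀ v, ((forestAt e t).neighborSet v).ncard ≤ Δ

/-- The number of edges of the component of `v` in `G`. -/
noncomputable def componentSize (G : SimpleGraph V) (v : V) : ℕ :=
  {f ∈ G.edgeSet | ∀ w ∈ f, G.Reachable v w}.ncard

/-! ### Partial edge-colorings with colors `[κ]` -/

/-- A partial edge-coloring; the value `none` means that the pair is not colored. -/
abbrev Coloring (V : Type*) (κ : ℕ) := Sym2 V → Option (Fin κ)

/-- `C` is a proper `κ`-edge-coloring of `G`: exactly the edges of `G` are colored, and any two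
distinct edges sharing a vertex have different colors. -/
def IsProperEdgeColoring (G : SimpleGraph V) (C : Coloring V κ) : Prop :=
  (∀ f, C f ≠ none ↔ f ∈ G.edgeSet) ∧
    ∀ u v w, v ≠ w → G.Adj u v → G.Adj u w → C s(u, v) ≠ C s(u, w)

open Classical in
/-- The colors available at `v`, i.e. not used on any edge incident to `v`. -/
noncomputable def available (C : Coloring V κ) (v : V) : Finset (Fin κ) :=
  {α | ∀ w, C s(v, w) ≠ some α}

/-- The recourse of a change of the coloring from `C` to `C'`: the number of previously colored
edges whose color changed. The first color of a new edge does not count. -/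
noncomputable def recourse (C C' : Coloring V κ) : ℕ :=
  {f | C f ≠ none ∧ C' f ≠ C f}.ncard

open Classical in
/-- The coloring `C` with the edge `uv` (re)colored by `α`. -/
noncomputable def setColor (C : Coloring V κ) (u v : V) (α : Fin κ) : Coloring V κ :=
  Function.update C s(u, v) (some α)

/-! ### The algorithm

In a rooted tree, the children of a vertex are its neighbors other than its parent; the procedures
below therefore receive the parent `p` of the vertex at which they are called. -/

open Classical in
/-- `FixForbidden` at the vertex `v` with parent `p`, whose parent edge changed its color from `α`
to `β`: if a child edge `vw` has color `β`, it is recolored to `α`, and the same procedure is called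
at `w` with the colors exchanged. The first argument bounds the number of recursive calls; the calls
descend in a tree, so that the number of vertices is always enough. -/
noncomputable def fixForbidden :
    ℕ → Coloring V κ → (p v : V) → (α β : Fin κ) → Coloring V κ
  | 0, C, _, _, _, _ => C
  | k + 1, C, p, v, α, β =>
    if h : ∃ w, w ≠ p ∧ C s(v, w) = some β then
      fixForbidden k (setColor C v h.choose α) v h.choose β α
    else C

open Classical in
/-- Continue with a uniformly random color available at `v`. (If there is none, which never happens
in a run on a legal sequence with `Δ ≤ κ`, nothing is done.) -/
noncomputable def withRandomAvailable (C : Coloring V κ) (v : V)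
    (next : Fin κ → PMF (Coloring V κ)) : PMF (Coloring V κ) :=
  if h : (available C v).Nonempty then (PMF.uniformOfFinset (available C v) h).bind next
  else PMF.pure C

open Classical in
/-- `RootToChild`: the former root `r` became a child of `p`, through an edge colored `β`. If a child
edge `rw` has color `β`, it is recolored to a uniformly random color `α` available at `r`, and
`FixForbidden` is called at `w`. -/
noncomputable def rootToChild [Fintype V] (C : Coloring V κ) (p r : V) (β : Fin κ) :
    PMF (Coloring V κ) :=
  if h : ∃ w, w ≠ p ∧ C s(r, w) = some β then
    withRandomAvailable C r fun α =>
      PMF.pure (fixForbidden (Fintype.card V) (setColor C r h.choose α) r h.choose β α)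
  else PMF.pure C

/-- The rerooting rule allows `v` to become the child when `uv` is inserted into `G`: if both
components have at most `Δ` edges, then the degrees are compared, otherwise the numbers of edges of
the components are. -/
def MayReroot (Δ : ℕ) (G : SimpleGraph V) (u v : V) : Prop :=
  (componentSize G v ≤ Δ ∧ componentSize G u ≤ Δ →
      (G.neighborSet v).ncard ≤ (G.neighborSet u).ncard) ∧
    (¬ (componentSize G v ≤ Δ ∧ componentSize G u ≤ Δ) → componentSize G v ≤ componentSize G u)

open Classical in
/-- The pair (parent, child) used for the insertion of `uv` into `G`. If the rerooting rule allows
both choices, then the bit `b` decides. -/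
noncomputable def orient (Δ : ℕ) (G : SimpleGraph V) (b : Bool) (u v : V) : V × V :=
  if MayReroot Δ G u v ∧ (¬ MayReroot Δ G v u ∨ b = true) then (u, v) else (v, u)

/-- The insertion of the edge `uv` into the forest `G`, colored by `C`: with `(p, r)` the chosen pair
(parent, child), the tree of `r` is rooted at `r`, the new edge gets a uniformly random color
available at `p`, and `RootToChild` is called at `r`. -/
noncomputable def insertEdge [Fintype V] (Δ : ℕ) (G : SimpleGraph V) (b : Bool) (u v : V)
    (C : Coloring V κ) : PMF (Coloring V κ) :=
  withRandomAvailable C (orient Δ G b u v).1 fun β =>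
    rootToChild (setColor C (orient Δ G b u v).1 (orient Δ G b u v).2 β)
      (orient Δ G b u v).1 (orient Δ G b u v).2 β

/-- The joint law of the current coloring and of the total recourse after the first `t` insertions
of `e`, with `tie t` breaking the tie, if any, in the choice of the root at the insertion `e t`. -/
noncomputable def run [Fintype V] (Δ κ : ℕ) (e : ℕ → V × V) (tie : ℕ → Bool) :
    ℕ → PMF (Coloring V κ × ℕ)
  | 0 => PMF.pure (fun _ => none, 0)
  | t + 1 => (run Δ κ e tie t).bind fun s =>
      (insertEdge Δ (forestAt e t) (tie t) (e t).1 (e t).2 s.1).map fun C' =>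
        (C', s.2 + recourse s.1 C')

/-- The law of the coloring after the first `t` insertions. -/
noncomputable def coloringLaw [Fintype V] (Δ κ : ℕ) (e : ℕ → V × V) (tie : ℕ → Bool) (t : ℕ) :
    PMF (Coloring V κ) :=
  (run Δ κ e tie t).map Prod.fst

/-- The expected amortized recourse over the first `m` insertions: the expected total recourse
divided by `m`. -/
noncomputable def expectedAmortizedRecourse [Fintype V] (Δ κ : ℕ) (e : ℕ → V × V)
    (tie : ℕ → Bool) (m : ℕ) : ℝ≥0∞ :=
  (∑' s, run Δ κ e tie m s * (s.2 : ℝ≥0∞)) / m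

end DistMaint

/-!
The theorem rests on two facts about the coloring of the current forest: it is uniformly distributed
after every insertion, and therefore the expected recourse of an insertion is a weighted count of
the edges of the rerooted tree, which can be amortized.

*Uniformity.* Let the new edge join the parent `p` to the child `r`, and fix its color `β`, available
at `p`. If `β` is also available at `r`, then coloring the new edge is a bijection onto the proper
colorings of the new forest in which the new edge has the color `β` (`sum_setColor_eq`). Otherwise,
for a fixed color `α` available at `r`, the algorithm exchanges `α` and `β` along a path that goes
down from `r`. Exchanging the colors again undoes this (`fixForbidden_fixForbidden`), so that it is a
bijection onto the proper colorings of the new forest in which the new edge has the color `β` and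
another edge at `r` has the color `α` (`sum_fixForbidden_eq`). As `r` has the same degree for all
colorings, every proper coloring of the new forest is reached with the same probability
(`sum_expect_insertBelow`).

*Cost of an insertion.* The colorings of different trees are independent, and the color of an edge
at `r` is uniform, so each of the edges at `r` has the conflicting color `β` with probability
`1 / κ`. Below, exchanging two colors in a subtree shows that each further edge continues the
alternating path with probability at most `1 / (κ - 1)` (`sum_chainLength_le`). So an edge at depth
`j` of the tree of `r` contributes at most `1 / (κ * (κ - 1) ^ (j - 1))` to the expected recourse.
If the tree has `s` edges, then the recourse is therefore at most `s / κ`, at most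
`(deg r + s / (κ - 1)) / κ` and, since a vertex has at most `κ` neighbors, by concavity at
most `4 * √(s / κ)` (`insertionCost_bounds`).

*Amortization.* Give each tree with `s` edges and maximal degree `M` the potential
`8 * min (s / Δ) √(s / Δ) + M / Δ`. If one of two joined trees has more than `Δ` edges, then the
smaller one becomes the subtree, and the loss of the first summand, which is concave in `s`, pays for
the insertion up to `O(1 / Δ)`. If both are small, then the recourse is at most the minimum of the
two degrees divided by `Δ`, plus `O(1 / Δ)`; and since the maximal degree of the union is at most one
more than the larger one of the two maximal degrees, the loss of the second summand pays for it
(`insertionCost_le_potential`).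

*Lower bound.* An insertion has expected recourse at least `deg r / κ` (`le_insertionCost`). When the
edges of a path are inserted in such an order that every second one comes first, a constant fraction
of the insertions has two ends of positive degree, so that every orientation costs at least `1 / κ`
with `κ ≤ 2 * Δ`.
-/

namespace DistMaint

variable {V : Type*} {κ : ℕ}

/-! ### Subtrees of a forest -/

/-- The vertex set of the subtree rooted at `v` when the parent of `v` is `p`: the vertices that
stay connected to `v` when the edge `pv` is deleted. -/
def side (G : SimpleGraph V) (p v : V) : Set V :=
  {x | (G.deleteEdges {s(p, v)}).Reachable v x}

section Side

variable {G : SimpleGraph V} {p v w x y : V}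

lemma self_mem_side : v ∈ side G p v := SimpleGraph.Reachable.refl v

lemma parent_notMem_side (hG : G.IsAcyclic) (h : G.Adj p v) : p ∉ side G p v := fun hp =>
  SimpleGraph.isBridge_iff.1 (SimpleGraph.isAcyclic_iff_forall_isBridge.1 hG
    (SimpleGraph.mem_edgeSet _ |>.2 h)) hp.symm

/-- The edge to the parent is the only edge that leaves a subtree. -/
lemma eq_of_adj_of_mem_side (hG : G.IsAcyclic) (h : G.Adj p v) (hx : x ∈ side G p v)
    (hxy : G.Adj x y) (hy : y ∉ side G p v) : x = v ∧ y = p := by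
  by_cases he : s(x, y) = s(p, v)
  · rcases Sym2.eq_iff.1 he with ⟨rfl, rfl⟩ | ⟨rfl, rfl⟩
    · exact absurd hx (parent_notMem_side hG h)
    · exact ⟨rfl, rfl⟩
  · exfalso
    apply hy
    refine SimpleGraph.Reachable.trans hx (SimpleGraph.Adj.reachable ?_)
    simp only [SimpleGraph.deleteEdges_adj, Set.mem_singleton_iff]
    exact ⟨hxy, he⟩

lemma child_mem_side (h : G.Adj v w) (hw : w ≠ p) : w ∈ side G p v := by
  refine SimpleGraph.Adj.reachable ?_
  simp only [SimpleGraph.deleteEdges_adj, Set.mem_singleton_iff]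
  refine ⟨h, fun he => ?_⟩
  rcases Sym2.eq_iff.1 he with ⟨rfl, rfl⟩ | ⟨_, rfl⟩
  · exact h.ne rfl
  · exact hw rfl

/-- Induction along the edges inside a subtree. -/
lemma side_induction {motive : V → Prop} (root : motive v)
    (step : ∀ x y, x ∈ side G p v → y ∈ side G p v → G.Adj x y → motive x → motive y)
    (hx : x ∈ side G p v) : motive x := by
  have hx' := (SimpleGraph.reachable_iff_reflTransGen _ _).1 hx
  induction hx' with
  | refl => exact root
  | tail hab hbc ih =>
    have hb := (SimpleGraph.reachable_iff_reflTransGen _ _).2 hab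
    exact step _ _ hb (hb.trans hbc.reachable)
      ((SimpleGraph.deleteEdges_adj.1 hbc).1) (ih hb)

lemma side_child_subset (hG : G.IsAcyclic) (h : G.Adj v w) (hw : w ≠ p) :
    side G v w ⊆ side G p v := by
  intro x hx
  refine side_induction (motive := (· ∈ side G p v)) (child_mem_side h hw) ?_ hx
  · intro x y hx hy hxy ih
    refine SimpleGraph.Reachable.trans ih (SimpleGraph.Adj.reachable ?_)
    simp only [SimpleGraph.deleteEdges_adj, Set.mem_singleton_iff]
    refine ⟨hxy, fun he => ?_⟩
    have hv := parent_notMem_side hG h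
    rcases Sym2.eq_iff.1 he with ⟨rfl, rfl⟩ | ⟨rfl, rfl⟩
    · exact hv hy
    · exact hv hx

lemma disjoint_side_child (hG : G.IsAcyclic) (h : G.Adj v x) (h' : G.Adj v y) (hxy : x ≠ y) :
    Disjoint (side G v x) (side G v y) := by
  rw [Set.disjoint_left]
  intro z hz hz'
  -- every vertex of the second subtree is outside the first: going back from `z` to `y` one never
  -- meets `v`, hence one never leaves the first subtree
  have hy : y ∉ side G v x := fun hy =>
    hxy (eq_of_adj_of_mem_side hG h hy h'.symm (parent_notMem_side hG h)).1.symm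
  refine side_induction (motive := fun z => z ∉ side G v x) hy ?_ hz' hz
  intro a b ha hb hab iha hb'
  obtain ⟨_, rfl⟩ := eq_of_adj_of_mem_side hG h hb' hab.symm iha
  exact parent_notMem_side hG h' ha

lemma side_child_ssubset (hG : G.IsAcyclic) (h : G.Adj v w) (hw : w ≠ p) :
    side G v w ⊂ side G p v :=
  ⟨side_child_subset hG h hw, fun hs => parent_notMem_side hG h (hs self_mem_side)⟩

end Side

/-! ### The recoloring procedure -/

/-- The edges of `G` are exactly the pairs that `C` colors. -/
def IsSupportedOn (G : SimpleGraph V) (C : Coloring V κ) : Prop :=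
  ∀ f, C f ≠ none ↔ f ∈ G.edgeSet

/-- Distinct edges that share a vertex and lie inside `S` have different colors. -/
def IsProperInside (G : SimpleGraph V) (S : Set V) (C : Coloring V κ) : Prop :=
  ∀ x ∈ S, ∀ y ∈ S, ∀ z ∈ S, y ≠ z → G.Adj x y → G.Adj x z → C s(x, y) ≠ C s(x, z)

section Fix

variable {G : SimpleGraph V} {C C' : Coloring V κ} {p v w x y : V} {a b : Fin κ}

lemma IsSupportedOn.adj (hC : IsSupportedOn G C) (h : C s(v, w) = some a) : G.Adj v w :=
  (SimpleGraph.mem_edgeSet _).1 ((hC _).1 (by simp [h]))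

lemma setColor_self : setColor C v w a s(v, w) = some a := by
  classical
  simp [setColor]

lemma setColor_of_ne {f : Sym2 V} (h : f ≠ s(v, w)) : setColor C v w a f = C f := by
  classical
  simp [setColor, Function.update_of_ne h]

lemma IsSupportedOn.setColor (hC : IsSupportedOn G C) (h : G.Adj v w) :
    IsSupportedOn G (setColor C v w a) := by
  intro f
  by_cases hf : f = s(v, w)
  · subst hf
    simp [setColor_self, h]
  · rw [setColor_of_ne hf]
    exact hC f

/-- If no child edge of `v` has color `b`, then `fixForbidden` does nothing. -/
lemma fixForbidden_of_not (k : ℕ) (h : ¬ ∃ w, w ≠ p ∧ C s(v, w) = some b) :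
    fixForbidden k C p v a b = C := by
  cases k with
  | zero => rfl
  | succ k => rw [fixForbidden, dif_neg h]

/-- The recursion step of `fixForbidden`, when the child edge of color `b` is unique. -/
lemma fixForbidden_succ (k : ℕ) (hw : w ≠ p) (h : C s(v, w) = some b)
    (huniq : ∀ w', w' ≠ p → C s(v, w') = some b → w' = w) :
    fixForbidden (k + 1) C p v a b = fixForbidden k (setColor C v w a) v w b a := by
  have hex : ∃ w, w ≠ p ∧ C s(v, w) = some b := ⟨w, hw, h⟩
  have hch : hex.choose = w := huniq _ hex.choose_spec.1 hex.choose_spec.2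
  rw [fixForbidden, dif_pos hex, hch]

lemma child_unique (hC : IsSupportedOn G C) (hP : IsProperInside G (side G p v) C) (hw : w ≠ p)
    (h : C s(v, w) = some b) : ∀ w', w' ≠ p → C s(v, w') = some b → w' = w := by
  intro w' hw' h'
  by_contra hne
  exact hP v self_mem_side w' (child_mem_side (hC.adj h') hw') w (child_mem_side (hC.adj h) hw) hne
    (hC.adj h') (hC.adj h) (h'.trans h.symm)

lemma fixForbidden_supported (k : ℕ) (hC : IsSupportedOn G C) :
    IsSupportedOn G (fixForbidden k C p v a b) := by
  induction k generalizing C p v a b with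
  | zero => exact hC
  | succ k ih =>
    rw [fixForbidden]
    split_ifs with h
    · exact ih (hC.setColor (hC.adj h.choose_spec.2))
    · exact hC

lemma not_inside_of_left {S : Set V} (h : x ∉ S) : ¬ ∀ z ∈ s(x, y), z ∈ S := by
  intro h'
  exact h (h' x (Sym2.mem_mk_left x y))

/-- Only edges inside the subtree are recolored. -/
lemma fixForbidden_outside (hG : G.IsAcyclic) (k : ℕ) (hC : IsSupportedOn G C) {f : Sym2 V}
    (hf : ¬ ∀ x ∈ f, x ∈ side G p v) : fixForbidden k C p v a b f = C f := by
  induction k generalizing C p v a b with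
  | zero => rfl
  | succ k ih =>
    rw [fixForbidden]
    split_ifs with h
    · obtain ⟨hw, hc⟩ := h.choose_spec
      have hadj := hC.adj hc
      rw [ih (hC.setColor hadj) fun hx => hf fun z hz => side_child_subset hG hadj hw (hx z hz),
        setColor_of_ne]
      rintro rfl
      apply hf
      intro x hx
      rcases Sym2.mem_iff.1 hx with rfl | rfl
      · exact self_mem_side
      · exact child_mem_side hadj hw
    · rfl

/-- The search for a child edge of a given color only depends on the subtree. -/
lemma child_congr (hC : ∀ v w a, C s(v, w) = some a → G.Adj v w)
    (hC' : ∀ v w a, C' s(v, w) = some a → G.Adj v w)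
    (heq : ∀ f : Sym2 V, (∀ x ∈ f, x ∈ side G p v) → C f = C' f) (w : V) :
    (w ≠ p ∧ C s(v, w) = some b) ↔ (w ≠ p ∧ C' s(v, w) = some b) := by
  have key : w ∈ side G p v → C s(v, w) = C' s(v, w) := fun hw => heq _ (by
    intro x hx
    rcases Sym2.mem_iff.1 hx with rfl | rfl
    · exact self_mem_side
    · exact hw)
  constructor
  · rintro ⟨hw, h⟩
    exact ⟨hw, key (child_mem_side (hC _ _ _ h) hw) ▸ h⟩
  · rintro ⟨hw, h⟩
    exact ⟨hw, (key (child_mem_side (hC' _ _ _ h) hw)).trans h⟩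

/-- The result of `fixForbidden` inside the subtree only depends on the colors inside it. -/
lemma fixForbidden_congr (hG : G.IsAcyclic) (k : ℕ) (hC : IsSupportedOn G C)
    (hC' : IsSupportedOn G C')
    (heq : ∀ f : Sym2 V, (∀ x ∈ f, x ∈ side G p v) → C f = C' f) {f : Sym2 V}
    (hf : ∀ x ∈ f, x ∈ side G p v) :
    fixForbidden k C p v a b f = fixForbidden k C' p v a b f := by
  induction k generalizing C C' p v a b with
  | zero => exact heq f hf
  | succ k ih =>
    have hiff : (fun w => w ≠ p ∧ C s(v, w) = some b) = fun w => w ≠ p ∧ C' s(v, w) = some b :=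
      funext fun w => propext (child_congr (fun _ _ _ => hC.adj) (fun _ _ _ => hC'.adj) heq w)
    by_cases h : ∃ w, w ≠ p ∧ C s(v, w) = some b
    · have h' : ∃ w, w ≠ p ∧ C' s(v, w) = some b := by rwa [← hiff]
      have hch : h.choose = h'.choose := by simp only [hiff]
      rw [fixForbidden, fixForbidden, dif_pos h, dif_pos h', ← hch]
      obtain ⟨hw, hc⟩ := h.choose_spec
      have hc' : C' s(v, h.choose) = some b := hch ▸ h'.choose_spec.2
      generalize h.choose = w at hw hc hc'
      have hadj := hC.adj hc
      have heq' : ∀ f : Sym2 V, (∀ x ∈ f, x ∈ side G p v) →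
          setColor C v w a f = setColor C' v w a f := by
        intro f hf
        by_cases hfe : f = s(v, w)
        · rw [hfe, setColor_self, setColor_self]
        · rw [setColor_of_ne hfe, setColor_of_ne hfe, heq f hf]
      by_cases hfw : ∀ x ∈ f, x ∈ side G v w
      · exact ih (hC.setColor hadj) (hC'.setColor hadj)
          (fun f hf => heq' f fun x hx => side_child_subset hG hadj hw (hf x hx)) hfw
      · rw [fixForbidden_outside hG k (hC.setColor hadj) hfw,
          fixForbidden_outside hG k (hC'.setColor hadj) hfw, heq' f hf]
    · have h' : ¬ ∃ w, w ≠ p ∧ C' s(v, w) = some b := by rwa [← hiff]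
      rw [fixForbidden_of_not _ h, fixForbidden_of_not _ h', heq f hf]

lemma sym2_ne_of_mem_side (hG : G.IsAcyclic) (h : G.Adj v w) (hx : x ∈ side G v w)
    (hy : y ∈ side G v w) : s(x, y) ≠ s(v, w) := by
  intro he
  have hv := parent_notMem_side hG h
  rcases Sym2.eq_iff.1 he with ⟨rfl, rfl⟩ | ⟨rfl, rfl⟩
  · exact hv hx
  · exact hv hy

/-- What the recursive call of `fixForbidden` relies on: after the child edge `vw` has been
recolored, the subtree at `w` is properly colored and does not use the old color of `vw` at `w`. -/
lemma setColor_isProperInside_child (hG : G.IsAcyclic) (hC : IsSupportedOn G C)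
    (hP : IsProperInside G (side G p v) C) (hw : w ≠ p) (hc : C s(v, w) = some b) :
    IsProperInside G (side G v w) (setColor C v w a) ∧
      ∀ x ∈ side G v w, setColor C v w a s(w, x) ≠ some b := by
  have hadj := hC.adj hc
  have hsub := side_child_subset hG hadj hw
  have hv := parent_notMem_side hG hadj
  constructor
  · intro x hx y hy z hz hyz hxy hxz
    rw [setColor_of_ne (sym2_ne_of_mem_side hG hadj hx hy),
      setColor_of_ne (sym2_ne_of_mem_side hG hadj hx hz)]
    exact hP x (hsub hx) y (hsub hy) z (hsub hz) hyz hxy hxz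
  · intro x hx hcx
    rw [setColor_of_ne (sym2_ne_of_mem_side hG hadj self_mem_side hx)] at hcx
    refine hP w (hsub self_mem_side) x (hsub hx) v self_mem_side (fun h => hv (h ▸ hx))
      (hC.adj hcx) hadj.symm ?_
    rw [hcx, Sym2.eq_swap, hc]

/-- With enough recursive calls, `fixForbidden` resolves the conflict at `v`: the subtree is again
properly colored, and now `b` is not used at `v` inside it. -/
lemma fixForbidden_isProperInside [Finite V] (hG : G.IsAcyclic) (k : ℕ) (hC : IsSupportedOn G C)
    (hab : a ≠ b) (hP : IsProperInside G (side G p v) C)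
    (ha : ∀ w ∈ side G p v, C s(v, w) ≠ some a) (hk : (side G p v).ncard ≤ k) :
    IsProperInside G (side G p v) (fixForbidden k C p v a b) ∧
      ∀ w ∈ side G p v, fixForbidden k C p v a b s(v, w) ≠ some b := by
  induction k generalizing C p v a b with
  | zero =>
    exact absurd (Set.ncard_pos (Set.toFinite (side G p v)) |>.2 ⟨v, self_mem_side⟩) (by omega)
  | succ k ih =>
    by_cases h : ∃ w, w ≠ p ∧ C s(v, w) = some b
    · obtain ⟨w, hw, hc⟩ := h
      rw [fixForbidden_succ k hw hc (child_unique hC hP hw hc)]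
      have hadj := hC.adj hc
      have hsub := side_child_subset hG hadj hw
      have hv := parent_notMem_side hG hadj
      obtain ⟨hP1, hb1⟩ := setColor_isProperInside_child (a := a) hG hC hP hw hc
      have hC1 := hC.setColor (a := a) hadj
      obtain ⟨hP2, ha2⟩ := ih hC1 hab.symm hP1 hb1 (by
        have := Set.ncard_lt_ncard (side_child_ssubset hG hadj hw) (Set.toFinite _)
        omega)
      have hout : ∀ {x y}, ¬ (x ∈ side G v w ∧ y ∈ side G v w) →
          fixForbidden k (setColor C v w a) v w b a s(x, y) = setColor C v w a s(x, y) := by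
        intro x y hxy
        refine fixForbidden_outside hG k hC1 fun hh => hxy ?_
        exact ⟨hh x (Sym2.mem_mk_left _ _), hh y (Sym2.mem_mk_right _ _)⟩
      have hvw : fixForbidden k (setColor C v w a) v w b a s(v, w) = some a := by
        rw [hout fun hh => hv hh.1, setColor_self]
      have hvy : ∀ y, y ≠ w →
          fixForbidden k (setColor C v w a) v w b a s(v, y) = C s(v, y) := by
        intro y hy
        rw [hout fun hh => hv hh.1, setColor_of_ne]
        simp [hy, hadj.ne]
      refine ⟨?_, ?_⟩
      · intro x hx y hy z hz hyz hxy hxz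
        by_cases hxv : x = v
        · subst hxv
          by_cases hyw : y = w
          · subst hyw
            rw [hvw, hvy z (Ne.symm hyz)]
            exact (ha z hz).symm
          · by_cases hzw : z = w
            · subst hzw
              rw [hvw, hvy y hyz]
              exact ha y hy
            · rw [hvy y hyw, hvy z hzw]
              exact hP x hx y hy z hz hyz hxy hxz
        · by_cases hxw : x ∈ side G v w
          · -- inside the subtree at `w`, the only edge that leaves it is `vw`, which has color `a`
            by_cases hyw : y ∈ side G v w
            · by_cases hzw : z ∈ side G v w
              · exact hP2 x hxw y hyw z hzw hyz hxy hxz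
              · obtain ⟨rfl, rfl⟩ := eq_of_adj_of_mem_side hG hadj hxw hxz hzw
                rw [Sym2.eq_swap (a := x) (b := z), hvw]
                exact ha2 y hyw
            · obtain ⟨rfl, rfl⟩ := eq_of_adj_of_mem_side hG hadj hxw hxy hyw
              have hzw : z ∈ side G y x := by
                by_contra hzw
                exact hyz (eq_of_adj_of_mem_side hG hadj hxw hxz hzw).2.symm
              rw [Sym2.eq_swap (a := x) (b := y), hvw]
              exact (ha2 z hzw).symm
          · have hne : ∀ t, s(x, t) ≠ s(v, w) := by
              intro t ht
              rcases Sym2.eq_iff.1 ht with ⟨rfl, rfl⟩ | ⟨rfl, rfl⟩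
              · exact hxv rfl
              · exact hxw self_mem_side
            rw [hout fun hh => hxw hh.1, hout fun hh => hxw hh.1, setColor_of_ne (hne _),
              setColor_of_ne (hne _)]
            exact hP x hx y hy z hz hyz hxy hxz
      · intro y hy hyb
        by_cases hyw : y = w
        · subst hyw
          rw [hvw] at hyb
          exact hab (Option.some.inj hyb)
        · rw [hvy y hyw] at hyb
          exact hP v self_mem_side y hy w (child_mem_side hadj hw) hyw (hC.adj hyb) hadj
            (hyb.trans hc.symm)
    · rw [fixForbidden_of_not _ h]
      refine ⟨hP, fun w hw hc => h ⟨w, ?_, hc⟩⟩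
      rintro rfl
      by_cases hvw : v = w
      · subst hvw
        exact (hC.adj hc).ne rfl
      · exact parent_notMem_side hG (hC.adj hc).symm hw

/-- `fixForbidden` with the colors exchanged undoes `fixForbidden`. -/
lemma fixForbidden_fixForbidden (hG : G.IsAcyclic) (k : ℕ) (hC : IsSupportedOn G C)
    (hp : G.Adj p v) (hab : a ≠ b) (hP : IsProperInside G (side G p v) C)
    (ha : ∀ w ∈ side G p v, C s(v, w) ≠ some a) :
    fixForbidden k (fixForbidden k C p v a b) p v b a = C := by
  induction k generalizing C p v a b with
  | zero => rfl
  | succ k ih =>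
    by_cases h : ∃ w, w ≠ p ∧ C s(v, w) = some b
    · obtain ⟨w, hw, hc⟩ := h
      have hadj := hC.adj hc
      have hv := parent_notMem_side hG hadj
      obtain ⟨hP1, hb1⟩ := setColor_isProperInside_child (a := a) hG hC hP hw hc
      have hC1 := hC.setColor (a := a) hadj
      have hih := ih hC1 hadj hab.symm hP1 hb1
      rw [fixForbidden_succ k hw hc (child_unique hC hP hw hc)]
      have hR := fixForbidden_supported k hC1 (p := v) (v := w) (a := b) (b := a)
      have hRo : ∀ f : Sym2 V, (¬ ∀ x ∈ f, x ∈ side G v w) →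
          fixForbidden k (setColor C v w a) v w b a f = setColor C v w a f :=
        fun f hf => fixForbidden_outside hG k hC1 hf
      generalize fixForbidden k (setColor C v w a) v w b a = R at hih hR hRo ⊢
      have hRw : R s(v, w) = some a := by
        rw [hRo _ (not_inside_of_left hv), setColor_self]
      have huniq : ∀ w', w' ≠ p → R s(v, w') = some a → w' = w := by
        intro w' hw' h'
        by_contra hne
        have hsub := child_mem_side (hR.adj h') hw'
        rw [hRo _ (not_inside_of_left hv), setColor_of_ne (by simp [hne, hadj.ne])] at h'
        exact ha w' hsub h'
      rw [fixForbidden_succ k hw hRw huniq]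
      have hR1 := hR.setColor (a := b) hadj
      funext f
      by_cases hf : ∀ x ∈ f, x ∈ side G v w
      · have hne : ∀ f : Sym2 V, (∀ x ∈ f, x ∈ side G v w) → f ≠ s(v, w) := by
          rintro f hf rfl
          exact hv (hf v (Sym2.mem_mk_left _ _))
        rw [fixForbidden_congr hG k hR1 hR (fun f hf => setColor_of_ne (hne f hf)) hf, hih,
          setColor_of_ne (hne f hf)]
      · rw [fixForbidden_outside hG k hR1 hf]
        by_cases hfe : f = s(v, w)
        · rw [hfe, setColor_self, hc]
        · rw [setColor_of_ne hfe, hRo f hf, setColor_of_ne hfe]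
    · rw [fixForbidden_of_not _ h, fixForbidden_of_not]
      rintro ⟨w, hw, hc⟩
      exact ha w (child_mem_side (hC.adj hc) hw) hc

open Classical in
/-- The number of edges recolored by `fixForbidden`, expressed through the original coloring: the
length of the alternating path that goes down from `v`, starting with the color `b`. -/
noncomputable def chainLength : ℕ → Coloring V κ → (p v : V) → (a b : Fin κ) → ℕ
  | 0, _, _, _, _, _ => 0
  | k + 1, C, p, v, a, b =>
    if h : ∃ w, w ≠ p ∧ C s(v, w) = some b then chainLength k C v h.choose b a + 1 else 0

lemma chainLength_of_not (k : ℕ) (h : ¬ ∃ w, w ≠ p ∧ C s(v, w) = some b) :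
    chainLength k C p v a b = 0 := by
  cases k with
  | zero => rfl
  | succ k => rw [chainLength, dif_neg h]

lemma chainLength_succ (k : ℕ) (hw : w ≠ p) (h : C s(v, w) = some b)
    (huniq : ∀ w', w' ≠ p → C s(v, w') = some b → w' = w) :
    chainLength (k + 1) C p v a b = chainLength k C v w b a + 1 := by
  have hex : ∃ w, w ≠ p ∧ C s(v, w) = some b := ⟨w, hw, h⟩
  have hch : hex.choose = w := huniq _ hex.choose_spec.1 hex.choose_spec.2
  rw [chainLength, dif_pos hex, hch]

lemma chainLength_congr (hG : G.IsAcyclic) (k : ℕ) (hC : ∀ v w a, C s(v, w) = some a → G.Adj v w)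
    (hC' : ∀ v w a, C' s(v, w) = some a → G.Adj v w)
    (heq : ∀ f : Sym2 V, (∀ x ∈ f, x ∈ side G p v) → C f = C' f) :
    chainLength k C p v a b = chainLength k C' p v a b := by
  induction k generalizing p v a b with
  | zero => rfl
  | succ k ih =>
    have hiff : (fun w => w ≠ p ∧ C s(v, w) = some b) = fun w => w ≠ p ∧ C' s(v, w) = some b :=
      funext fun w => propext (child_congr hC hC' heq w)
    by_cases h : ∃ w, w ≠ p ∧ C s(v, w) = some b
    · have h' : ∃ w, w ≠ p ∧ C' s(v, w) = some b := by rwa [← hiff]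
      have hch : h.choose = h'.choose := by simp only [hiff]
      rw [chainLength, chainLength, dif_pos h, dif_pos h', ← hch]
      obtain ⟨hw, hc⟩ := h.choose_spec
      rw [ih fun f hf => heq f fun x hx => side_child_subset hG (hC _ _ _ hc) hw (hf x hx)]
    · have h' : ¬ ∃ w, w ≠ p ∧ C' s(v, w) = some b := by rwa [← hiff]
      rw [chainLength_of_not _ h, chainLength_of_not _ h']

lemma ncard_fixForbidden_ne [Finite V] (hG : G.IsAcyclic) (k : ℕ) (hC : IsSupportedOn G C)
    (hab : a ≠ b) (hP : IsProperInside G (side G p v) C) :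
    {f | fixForbidden k C p v a b f ≠ C f}.ncard = chainLength k C p v a b := by
  induction k generalizing C p v a b with
  | zero => simp [fixForbidden, chainLength]
  | succ k ih =>
    by_cases h : ∃ w, w ≠ p ∧ C s(v, w) = some b
    · obtain ⟨w, hw, hc⟩ := h
      have hadj := hC.adj hc
      have hv := parent_notMem_side hG hadj
      obtain ⟨hP1, _⟩ := setColor_isProperInside_child (a := a) hG hC hP hw hc
      have hC1 := hC.setColor (a := a) hadj
      have hu := child_unique hC hP hw hc
      have hvw : fixForbidden k (setColor C v w a) v w b a s(v, w) = some a := by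
        rw [fixForbidden_outside hG k hC1 (not_inside_of_left hv), setColor_self]
      rw [fixForbidden_succ k hw hc hu, chainLength_succ k hw hc hu]
      rw [chainLength_congr (C' := setColor C v w a) hG k (fun _ _ _ => hC.adj) fun _ _ _ => hC1.adj,
        ← ih hC1 hab.symm hP1]
      · rw [← Set.ncard_insert_of_notMem (a := s(v, w)) _ (Set.toFinite _)]
        · congr 1
          ext f
          by_cases hf : f = s(v, w)
          · subst hf
            simp [hvw, hc, hab]
          · simp [hf, setColor_of_ne hf]
        · simp [hvw, setColor_self]
      · intro f hf
        rw [setColor_of_ne]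
        rintro rfl
        exact hv (hf v (Sym2.mem_mk_left _ _))
    · rw [fixForbidden_of_not _ h, chainLength_of_not _ h]
      simp

end Fix

/-! ### Counting proper colorings by exchanging two colors on a part of the forest -/

section Count

variable {G : SimpleGraph V} {C : Coloring V κ} {p v w : V} {a b : Fin κ}

lemma IsProperEdgeColoring.isSupportedOn (h : IsProperEdgeColoring G C) : IsSupportedOn G C := h.1

lemma IsProperEdgeColoring.isProperInside (h : IsProperEdgeColoring G C) (S : Set V) :
    IsProperInside G S C := fun x _ y _ z _ hyz hxy hxz => h.2 x y z hyz hxy hxz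

lemma IsProperEdgeColoring.eq_of_color_eq (h : IsProperEdgeColoring G C) {w' : V}
    (hw : C s(v, w) = some a) (hw' : C s(v, w') = some a) : w' = w := by
  by_contra hne
  exact h.2 v w' w hne (h.isSupportedOn.adj hw') (h.isSupportedOn.adj hw) (hw'.trans hw.symm)

lemma mem_available : a ∈ available C v ↔ ∀ w, C s(v, w) ≠ some a := by
  simp [available]

lemma notMem_available : a ∉ available C v ↔ ∃ w, C s(v, w) = some a := by
  simp [available]

/-- A vertex of degree `d` has `κ - d` available colors. -/
lemma card_available_add [Finite V] (h : IsProperEdgeColoring G C) (v : V) :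
    (available C v).card + (G.neighborSet v).ncard = κ := by
  classical
  have hc : (G.neighborSet v).ncard = ((available C v)ᶜ : Finset (Fin κ)).card := by
    rw [← Set.ncard_coe_finset]
    have hne : ∀ w ∈ G.neighborSet v, (C s(v, w)).isSome := fun w hw =>
      Option.isSome_iff_ne_none.2 ((h.1 _).2 hw)
    refine Set.ncard_congr (fun w hw => (C s(v, w)).get (hne w hw)) ?_ ?_ ?_
    · intro w hw
      simp only [Finset.coe_compl, Set.mem_compl_iff, Finset.mem_coe, notMem_available]
      exact ⟨w, (Option.some_get _).symm⟩
    · intro w w' hw hw' heq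
      by_contra hne'
      exact h.2 v w w' hne' hw hw' (Option.get_inj.1 heq)
    · intro c hc
      simp only [Finset.coe_compl, Set.mem_compl_iff, Finset.mem_coe, notMem_available] at hc
      obtain ⟨w, hw⟩ := hc
      exact ⟨w, h.isSupportedOn.adj hw, by simp [hw]⟩
  rw [hc, Finset.card_add_card_compl, Fintype.card_fin]

open Classical in
/-- The coloring `C` with the colors `a` and `b` exchanged on all edges inside `S`. -/
noncomputable def swapOn (S : Set V) (a b : Fin κ) (C : Coloring V κ) : Coloring V κ :=
  fun f => if ∀ x ∈ f, x ∈ S then (C f).map (Equiv.swap a b) else C f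

variable {S : Set V}

lemma swapOn_inside {f : Sym2 V} (hf : ∀ x ∈ f, x ∈ S) :
    swapOn S a b C f = (C f).map (Equiv.swap a b) := if_pos hf

lemma swapOn_outside {f : Sym2 V} (hf : ¬ ∀ x ∈ f, x ∈ S) : swapOn S a b C f = C f := if_neg hf

lemma swapOn_swapOn : swapOn S a b (swapOn S a b C) = C := by
  funext f
  by_cases hf : ∀ x ∈ f, x ∈ S
  · rw [swapOn_inside hf, swapOn_inside hf, Option.map_map]
    simp [← Equiv.coe_trans]
  · rw [swapOn_outside hf, swapOn_outside hf]

/-- Exchanging two colors inside `S` keeps a coloring proper if no edge that leaves `S` has one of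
these two colors. -/
lemma IsProperEdgeColoring.swapOn (h : IsProperEdgeColoring G C)
    (hS : ∀ x ∈ S, ∀ y, y ∉ S → G.Adj x y → C s(x, y) ≠ some a ∧ C s(x, y) ≠ some b) :
    IsProperEdgeColoring G (swapOn S a b C) := by
  refine ⟨fun f => ?_, fun x y z hyz hxy hxz => ?_⟩
  · rw [← h.1 f]
    by_cases hf : ∀ x ∈ f, x ∈ S
    · simp [swapOn_inside hf]
    · rw [swapOn_outside hf]
  · have hne := h.2 x y z hyz hxy hxz
    have hins : ∀ y z, (∀ t ∈ s(x, y), t ∈ S) → (¬ ∀ t ∈ s(x, z), t ∈ S) → G.Adj x z →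
        C s(x, y) ≠ C s(x, z) → (C s(x, y)).map (Equiv.swap a b) ≠ C s(x, z) := by
      intro y z hy hz hxz hne heq
      have hx : x ∈ S := hy x (Sym2.mem_mk_left _ _)
      have hzS : z ∉ S := fun hzS => hz fun t ht => by
        rcases Sym2.mem_iff.1 ht with rfl | rfl <;> assumption
      obtain ⟨h1, h2⟩ := hS x hx z hzS hxz
      obtain ⟨c, hc⟩ := Option.ne_none_iff_exists'.1 ((h.1 s(x, z)).2 hxz)
      rw [hc] at h1 h2 heq hne
      obtain ⟨d, hd, hdc⟩ := Option.map_eq_some_iff.1 heq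
      have h3 : d = c := by
        rw [← Equiv.swap_apply_of_ne_of_ne (a := a) (b := b) (x := c)
          (fun hh => h1 (by rw [hh])) (fun hh => h2 (by rw [hh]))] at hdc
        exact (Equiv.swap a b).injective hdc
      exact hne (hd.trans (by rw [h3]))
    by_cases hy : ∀ t ∈ s(x, y), t ∈ S <;> by_cases hz : ∀ t ∈ s(x, z), t ∈ S
    · rw [swapOn_inside hy, swapOn_inside hz]
      exact fun heq => hne (Option.map_injective (Equiv.swap a b).injective heq)
    · rw [swapOn_inside hy, swapOn_outside hz]
      exact hins y z hy hz hxz hne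
    · rw [swapOn_outside hy, swapOn_inside hz]
      exact (hins z y hz hy hxy hne.symm).symm
    · rwa [swapOn_outside hy, swapOn_outside hz]

variable {Ω : Finset (Coloring V κ)} {Γ : Finset (Fin κ)} {f : Sym2 V}

open Classical in
lemma card_filter_color_eq (hΩ : ∀ C ∈ Ω, ∀ c ∈ Γ, ∀ d ∈ Γ, swapOn S c d C ∈ Ω)
    (hf : ∀ x ∈ f, x ∈ S) (ha : a ∈ Γ) (hb : b ∈ Γ) :
    (Ω.filter fun C => C f = some a).card = (Ω.filter fun C => C f = some b).card := by
  refine Finset.card_nbij' (swapOn S a b) (swapOn S a b) ?_ ?_ (fun _ _ => swapOn_swapOn)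
    (fun _ _ => swapOn_swapOn)
  · intro C hC
    simp only [Finset.coe_filter, Set.mem_ofPred_eq] at hC ⊢
    exact ⟨hΩ C hC.1 a ha b hb, by simp [swapOn_inside hf, hC.2]⟩
  · intro C hC
    simp only [Finset.coe_filter, Set.mem_ofPred_eq] at hC ⊢
    exact ⟨hΩ C hC.1 a ha b hb, by simp [swapOn_inside hf, hC.2]⟩

open Classical in
/-- If the colors in `Γ` may be exchanged with each other inside `S`, then each of them is taken by
an edge inside `S` with frequency at most `1 / |Γ|`. -/
lemma card_mul_card_filter_color_le (hΩ : ∀ C ∈ Ω, ∀ c ∈ Γ, ∀ d ∈ Γ, swapOn S c d C ∈ Ω)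
    (hf : ∀ x ∈ f, x ∈ S) (hb : b ∈ Γ) :
    Γ.card * (Ω.filter fun C => C f = some b).card ≤ Ω.card := by
  rw [← smul_eq_mul, ← Finset.sum_const,
    Finset.sum_congr rfl fun c hc => card_filter_color_eq hΩ hf hb hc,
    ← Finset.card_biUnion]
  · exact Finset.card_le_card (Finset.biUnion_subset.2 fun _ _ => Finset.filter_subset _ _)
  · intro c _ d _ hcd
    refine Finset.disjoint_left.2 ?_
    intro C hC hC'
    exact hcd (Option.some.inj ((Finset.mem_filter.1 hC).2.symm.trans (Finset.mem_filter.1 hC').2))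

open Classical in
lemma card_mul_card_filter_color (hΩ : ∀ C ∈ Ω, ∀ c ∈ Γ, ∀ d ∈ Γ, swapOn S c d C ∈ Ω)
    (hf : ∀ x ∈ f, x ∈ S) (hb : b ∈ Γ) (hΓ : ∀ C ∈ Ω, ∃ c ∈ Γ, C f = some c) :
    Γ.card * (Ω.filter fun C => C f = some b).card = Ω.card := by
  refine le_antisymm (card_mul_card_filter_color_le hΩ hf hb) ?_
  rw [← smul_eq_mul, ← Finset.sum_const,
    Finset.sum_congr rfl fun c hc => card_filter_color_eq hΩ hf hb hc]
  refine le_trans (Finset.card_le_card ?_) Finset.card_biUnion_le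
  intro C hC
  obtain ⟨c, hc, h⟩ := hΓ C hC
  exact Finset.mem_biUnion.2 ⟨c, hc, Finset.mem_filter.2 ⟨hC, h⟩⟩

end Count

/-! ### The expected length of the recolored path -/

section Weight

variable [Fintype V] {G : SimpleGraph V} {p v w : V} {a b : Fin κ}

open Classical in
/-- The children of `v`, when its parent is `p`. -/
noncomputable def children (G : SimpleGraph V) (p v : V) : Finset V :=
  Finset.univ.filter fun w => w ≠ p ∧ G.Adj v w

lemma mem_children : w ∈ children G p v ↔ w ≠ p ∧ G.Adj v w := by
  simp [children]

/-- The sum of `(κ - 1) ^ (-j)` over the edges in the first `k` levels of the subtree of `v` with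
parent `p`, where `j` is the depth of the edge. -/
noncomputable def chainWeight (κ : ℕ) (G : SimpleGraph V) : ℕ → V → V → ℝ
  | 0, _, _ => 0
  | k + 1, p, v => ∑ w ∈ children G p v, (1 + chainWeight κ G k v w) / ((κ : ℝ) - 1)

open Classical in
lemma chainLength_succ_eq_sum {C : Coloring V κ} (hC : IsProperEdgeColoring G C) (k : ℕ)
    {F : Finset V} (hF : ∀ w, w ∈ F ↔ w ≠ p ∧ G.Adj v w) :
    chainLength (k + 1) C p v a b =
      ∑ w ∈ F, if C s(v, w) = some b then chainLength k C v w b a + 1 else 0 := by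
  by_cases h : ∃ w, w ≠ p ∧ C s(v, w) = some b
  · obtain ⟨w, hw, hc⟩ := h
    have hu : ∀ w', w' ≠ p → C s(v, w') = some b → w' = w :=
      fun w' _ h' => hC.eq_of_color_eq hc h'
    rw [chainLength_succ k hw hc hu, Finset.sum_eq_single w]
    · rw [if_pos hc]
    · intro w' hw' hne
      rw [if_neg fun h' => hne (hu w' ((hF w').1 hw').1 h')]
    · intro hwF
      exact absurd ((hF w).2 ⟨hw, hC.isSupportedOn.adj hc⟩) hwF
  · rw [chainLength_of_not _ h, Finset.sum_eq_zero]
    intro w hw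
    rw [if_neg fun h' => h ⟨w, ((hF w).1 hw).1, h'⟩]

/-- Consider a family of proper colorings that give the color `a` to the edge `pv` and that is only
restricted outside the subtree of `v`. On average over the family, the alternating path that enters
the subtree of `v` has at most the length `chainWeight`: by exchanging colors in subtrees, every
further edge has the required color with probability at most `1 / (κ - 1)`. -/
lemma sum_chainLength_le (hG : G.IsAcyclic) (k : ℕ) (hp : G.Adj p v) (hab : a ≠ b)
    (Ω : Finset (Coloring V κ)) (hΩ : ∀ C ∈ Ω, IsProperEdgeColoring G C)
    (ha : ∀ C ∈ Ω, C s(p, v) = some a)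
    (hfree : ∀ C ∈ Ω, ∀ C', IsProperEdgeColoring G C' →
      (∀ f : Sym2 V, (¬ ∀ x ∈ f, x ∈ side G p v) → C' f = C f) → C' ∈ Ω) :
    ∑ C ∈ Ω, (chainLength k C p v a b : ℝ) ≤ Ω.card * chainWeight κ G k p v := by
  classical
  induction k generalizing p v a b Ω with
  | zero => simp [chainLength, chainWeight]
  | succ k ih =>
    have hκ : (1 : ℝ) < κ := by
      have : 1 < κ := by
        have h1 := a.2
        have h2 := b.2
        have : (a : ℕ) ≠ b := fun h => hab (Fin.ext h)
        omega
      exact_mod_cast this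
    calc ∑ C ∈ Ω, (chainLength (k + 1) C p v a b : ℝ)
        = ∑ C ∈ Ω, ∑ w ∈ children G p v,
            if C s(v, w) = some b then (chainLength k C v w b a : ℝ) + 1 else 0 := by
          refine Finset.sum_congr rfl fun C hC => ?_
          rw [chainLength_succ_eq_sum (hΩ C hC) k fun _ => mem_children]
          push_cast
          rfl
      _ = ∑ w ∈ children G p v, ∑ C ∈ Ω.filter (fun C => C s(v, w) = some b),
            ((chainLength k C v w b a : ℝ) + 1) := by
          rw [Finset.sum_comm]
          simp only [Finset.sum_filter]
      _ ≤ ∑ w ∈ children G p v, Ω.card * ((1 + chainWeight κ G k v w) / ((κ : ℝ) - 1)) := by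
          refine Finset.sum_le_sum fun w hw => ?_
          obtain ⟨hwp, hvw⟩ := mem_children.1 hw
          have hsub := side_child_subset hG hvw hwp
          have hv := parent_notMem_side hG hvw
          set Ω' := Ω.filter (fun C => C s(v, w) = some b) with hΩ'
          have h1 : ∑ C ∈ Ω', (chainLength k C v w b a : ℝ) ≤ Ω'.card * chainWeight κ G k v w := by
            refine ih hvw hab.symm Ω' (fun C hC => hΩ C (Finset.mem_filter.1 hC).1)
              (fun C hC => (Finset.mem_filter.1 hC).2) ?_
            intro C hC C' hC' heq
            obtain ⟨hCΩ, hCb⟩ := Finset.mem_filter.1 hC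
            refine Finset.mem_filter.2 ⟨hfree C hCΩ C' hC' fun f hf => heq f fun h => hf fun x hx =>
              hsub (h x hx), ?_⟩
            rw [heq _ (not_inside_of_left hv), hCb]
          have h2 : (κ - 1) * Ω'.card ≤ Ω.card := by
            have := card_mul_card_filter_color_le (Ω := Ω) (S := side G p v)
              (Γ := Finset.univ.erase a) (f := s(v, w)) (b := b) ?_ ?_ ?_
            · rwa [Finset.card_erase_of_mem (Finset.mem_univ _), Finset.card_univ,
                Fintype.card_fin] at this
            · intro C hC c hc d hd
              refine hfree C hC _ ((hΩ C hC).swapOn ?_) fun f hf => swapOn_outside hf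
              intro x hx y hy hxy
              obtain ⟨rfl, rfl⟩ := eq_of_adj_of_mem_side hG hp hx hxy hy
              rw [Sym2.eq_swap, ha C hC]
              simp only [ne_eq, Option.some.injEq]
              exact ⟨(Finset.ne_of_mem_erase hc).symm, (Finset.ne_of_mem_erase hd).symm⟩
            · intro x hx
              rcases Sym2.mem_iff.1 hx with rfl | rfl
              · exact self_mem_side
              · exact child_mem_side hvw hwp
            · exact Finset.mem_erase.2 ⟨hab.symm, Finset.mem_univ _⟩
          have h3 : ((κ : ℝ) - 1) * Ω'.card ≤ Ω.card := by
            have h4 : (((κ - 1 : ℕ) : ℝ)) * Ω'.card ≤ Ω.card := by exact_mod_cast h2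
            rwa [Nat.cast_sub (by exact_mod_cast hκ.le), Nat.cast_one] at h4
          have hW : 0 ≤ chainWeight κ G k v w := by
            clear * - hκ
            induction k generalizing v w with
            | zero => simp [chainWeight]
            | succ k ih =>
              exact Finset.sum_nonneg fun x _ => div_nonneg (by linarith [@ih w x]) (by linarith)
          rw [Finset.sum_add_distrib, Finset.sum_const, nsmul_eq_mul, mul_one, ← mul_div_assoc,
            le_div_iff₀ (by linarith)]
          calc (∑ C ∈ Ω', (chainLength k C v w b a : ℝ) + Ω'.card) * ((κ : ℝ) - 1)
              ≤ (Ω'.card * chainWeight κ G k v w + Ω'.card) * ((κ : ℝ) - 1) := by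
                gcongr
            _ = (((κ : ℝ) - 1) * Ω'.card) * (1 + chainWeight κ G k v w) := by ring
            _ ≤ Ω.card * (1 + chainWeight κ G k v w) := by gcongr
      _ = Ω.card * chainWeight κ G (k + 1) p v := by
          rw [chainWeight, Finset.mul_sum]

/-- Disjoint subtrees below `v`, together with `v`, fit into a set that contains them. -/
lemma sum_ncard_side_add_one_le (hG : G.IsAcyclic) {F : Finset V} (hF : ∀ w ∈ F, G.Adj v w)
    {S : Set V} (hv : v ∈ S) (hS : ∀ w ∈ F, side G v w ⊆ S) :
    ∑ w ∈ F, (side G v w).ncard + 1 ≤ S.ncard := by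
  classical
  have h1 : ∑ w ∈ F, (side G v w).ncard = (⋃ w ∈ F, side G v w).ncard := by
    clear hS
    induction F using Finset.induction_on with
    | empty => simp
    | insert x F hx ih =>
      rw [Finset.sum_insert hx, ih fun w hw => hF w (Finset.mem_insert_of_mem hw),
        Finset.set_biUnion_insert, Set.ncard_union_eq]
      simp only [Set.disjoint_iUnion_right]
      intro w hw
      exact disjoint_side_child hG (hF x (Finset.mem_insert_self _ _))
        (hF w (Finset.mem_insert_of_mem hw)) (fun h => hx (h ▸ hw))
  have h2 : v ∉ ⋃ w ∈ F, side G v w := by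
    simp only [Set.mem_iUnion, not_exists]
    intro w hw
    exact parent_notMem_side hG (hF w hw)
  rw [h1, ← Set.ncard_insert_of_notMem h2]
  refine Set.ncard_le_ncard (Set.insert_subset hv (Set.iUnion₂_subset hS)) (Set.toFinite _)

lemma one_le_ncard_side : 1 ≤ (side G p v).ncard :=
  Set.ncard_pos (Set.toFinite _) |>.2 ⟨v, self_mem_side⟩

lemma chainWeight_le_linear (hG : G.IsAcyclic) (hκ : 2 ≤ κ) (k : ℕ) :
    chainWeight κ G k p v ≤ (((side G p v).ncard : ℝ) - 1) / ((κ : ℝ) - 1) := by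
  have hκ' : (1 : ℝ) ≤ (κ : ℝ) - 1 := by
    have : (2 : ℝ) ≤ κ := by exact_mod_cast hκ
    linarith
  have hone : ∀ p v : V, (1 : ℝ) ≤ ((side G p v).ncard : ℝ) := fun p v => by
    exact_mod_cast one_le_ncard_side
  induction k generalizing p v with
  | zero => exact div_nonneg (by linarith [hone p v]) (by linarith)
  | succ k ih =>
    have hs : ∑ w ∈ children G p v, ((side G v w).ncard : ℝ) + 1 ≤ (side G p v).ncard := by
      exact_mod_cast sum_ncard_side_add_one_le hG (fun w hw => (mem_children.1 hw).2) self_mem_side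
        fun w hw => side_child_subset hG (mem_children.1 hw).2 (mem_children.1 hw).1
    rw [chainWeight, ← Finset.sum_div]
    gcongr
    calc ∑ w ∈ children G p v, (1 + chainWeight κ G k v w)
        ≤ ∑ w ∈ children G p v, ((side G v w).ncard : ℝ) := by
          refine Finset.sum_le_sum fun w _ => ?_
          have := (ih (p := v) (v := w)).trans (div_le_self (by linarith [hone v w]) hκ')
          linarith
      _ ≤ _ := by linarith

/-- The concavity argument behind the square root bound on the weights: the constant `4` satisfies
`1 + 4 / √2 ≤ 4`. -/
lemma sum_one_add_sqrt_le {ι : Type*} (F : Finset ι) (z : ι → ℝ) (hz : ∀ w ∈ F, 1 ≤ z w) {x q : ℝ}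
    (hx : ∑ w ∈ F, z w ≤ x) (hq : (F.card : ℝ) ≤ q) :
    ∑ w ∈ F, (1 + 4 * √((z w - 1) / 2)) ≤ 4 * √(q * x) := by
  have h1 : ∀ w ∈ F, 1 + 4 * √((z w - 1) / 2) ≤ 4 * √(z w) := by
    intro w hw
    have hzw := hz w hw
    have h2 : √((z w - 1) / 2) ≤ 3 / 4 * √(z w) := by
      rw [Real.sqrt_le_left (by positivity), mul_pow, Real.sq_sqrt (by linarith)]
      linarith
    have h3 : 1 ≤ √(z w) := Real.one_le_sqrt.2 hzw
    linarith
  refine (Finset.sum_le_sum h1).trans ?_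
  rw [← Finset.mul_sum]
  gcongr
  refine Real.le_sqrt_of_sq_le ?_
  refine (sq_sum_le_card_mul_sum_sq).trans ?_
  rw [Finset.sum_congr rfl fun w hw => Real.sq_sqrt (by linarith [hz w hw] : (0 : ℝ) ≤ z w)]
  have : 0 ≤ ∑ w ∈ F, z w := Finset.sum_nonneg fun w hw => by linarith [hz w hw]
  gcongr
  exact (Nat.cast_nonneg _).trans hq

lemma ncard_neighborSet_eq_card_children_add_one (hp : G.Adj p v) :
    (children G p v).card + 1 = (G.neighborSet v).ncard := by
  classical
  have : G.neighborSet v = insert p (children G p v : Set V) := by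
    ext w
    simp only [SimpleGraph.mem_neighborSet, Set.mem_insert_iff, Finset.mem_coe, mem_children]
    by_cases h : w = p
    · subst h
      simp [hp.symm]
    · simp [h]
  rw [this, Set.ncard_insert_of_notMem, Set.ncard_coe_finset]
  simp [mem_children]

lemma chainWeight_le_sqrt (hG : G.IsAcyclic) (hκ : 3 ≤ κ)
    (hdeg : ∀ v, (G.neighborSet v).ncard ≤ κ) (k : ℕ) (hp : G.Adj p v) :
    chainWeight κ G k p v ≤ 4 * √((((side G p v).ncard : ℝ) - 1) / ((κ : ℝ) - 1)) := by
  have hκ' : (2 : ℝ) ≤ (κ : ℝ) - 1 := by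
    have : (3 : ℝ) ≤ κ := by exact_mod_cast hκ
    linarith
  have hone : ∀ p v : V, (1 : ℝ) ≤ ((side G p v).ncard : ℝ) := fun p v => by
    exact_mod_cast one_le_ncard_side
  induction k generalizing p v with
  | zero => simp [chainWeight]
  | succ k ih =>
    have hs : ∑ w ∈ children G p v, ((side G v w).ncard : ℝ) + 1 ≤ (side G p v).ncard := by
      exact_mod_cast sum_ncard_side_add_one_le hG (fun w hw => (mem_children.1 hw).2) self_mem_side
        fun w hw => side_child_subset hG (mem_children.1 hw).2 (mem_children.1 hw).1
    have hcard : ((children G p v).card : ℝ) ≤ (κ : ℝ) - 1 := by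
      have h1 := ncard_neighborSet_eq_card_children_add_one hp
      have h2 := hdeg v
      have h3 : (((children G p v).card + 1 : ℕ) : ℝ) ≤ κ := by
        rw [h1]
        exact_mod_cast h2
      push_cast at h3
      linarith
    have h4 := sum_one_add_sqrt_le (children G p v) (fun w => ((side G v w).ncard : ℝ))
      (fun w _ => hone v w) (x := ((side G p v).ncard : ℝ) - 1) (by linarith) hcard
    rw [chainWeight, ← Finset.sum_div, div_le_iff₀ (by linarith)]
    calc ∑ w ∈ children G p v, (1 + chainWeight κ G k v w)
        ≤ ∑ w ∈ children G p v, (1 + 4 * √((((side G v w).ncard : ℝ) - 1) / 2)) := by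
          refine Finset.sum_le_sum fun w hw => ?_
          have := ih (mem_children.1 hw).2
          have h5 : √((((side G v w).ncard : ℝ) - 1) / ((κ : ℝ) - 1)) ≤
              √((((side G v w).ncard : ℝ) - 1) / 2) := by
            apply Real.sqrt_le_sqrt
            have := hone v w
            gcongr
          linarith
      _ ≤ 4 * √(((κ : ℝ) - 1) * (((side G p v).ncard : ℝ) - 1)) := h4
      _ = 4 * √((((side G p v).ncard : ℝ) - 1) / ((κ : ℝ) - 1)) * ((κ : ℝ) - 1) := by
          have h5 : ((κ : ℝ) - 1) * (((side G p v).ncard : ℝ) - 1) =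
              (((side G p v).ncard : ℝ) - 1) / ((κ : ℝ) - 1) * ((κ : ℝ) - 1) ^ 2 := by
            field_simp
          rw [h5, Real.sqrt_mul' _ (sq_nonneg _), Real.sqrt_sq (by linarith), mul_assoc]

end Weight

/-! ### Expectations of finite experiments -/

/-- The expectation of a nonnegative function under a discrete law. -/
noncomputable def expect {α : Type*} (μ : PMF α) (f : α → ℝ≥0∞) : ℝ≥0∞ := ∑' x, μ x * f x

section Expect

variable {α β : Type*}

lemma expect_pure (x : α) (f : α → ℝ≥0∞) : expect (PMF.pure x) f = f x := by
  classical
  rw [expect, tsum_eq_single x]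
  · simp
  · intro y hy
    simp [PMF.pure_apply, hy]

lemma expect_bind (μ : PMF α) (g : α → PMF β) (f : β → ℝ≥0∞) :
    expect (μ.bind g) f = expect μ fun x => expect (g x) f := by
  simp only [expect, PMF.bind_apply, ← ENNReal.tsum_mul_right, ← ENNReal.tsum_mul_left]
  rw [ENNReal.tsum_comm]
  simp only [mul_assoc]

lemma expect_map (μ : PMF α) (g : α → β) (f : β → ℝ≥0∞) :
    expect (μ.map g) f = expect μ (f ∘ g) := by
  simp only [PMF.map, expect_bind, Function.comp_def, expect_pure]

lemma expect_add (μ : PMF α) (f g : α → ℝ≥0∞) :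
    (expect μ fun x => f x + g x) = expect μ f + expect μ g := by
  simp only [expect, mul_add]
  exact ENNReal.tsum_add

lemma expect_const (μ : PMF α) (c : ℝ≥0∞) : (expect μ fun _ => c) = c := by
  rw [expect, ENNReal.tsum_mul_right, PMF.tsum_coe, one_mul]

lemma expect_uniformOfFinset (s : Finset α) (hs : s.Nonempty) (f : α → ℝ≥0∞) :
    expect (PMF.uniformOfFinset s hs) f = (s.card : ℝ≥0∞)⁻¹ * ∑ x ∈ s, f x := by
  rw [expect, tsum_eq_sum (s := s), Finset.mul_sum]
  · exact Finset.sum_congr rfl fun x hx => by rw [PMF.uniformOfFinset_apply_of_mem hs hx]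
  · intro x hx
    rw [PMF.uniformOfFinset_apply_of_notMem hs hx, zero_mul]

lemma expect_withRandomAvailable (C : Coloring V κ) (v : V)
    (next : Fin κ → PMF (Coloring V κ)) (h : (available C v).card ≠ 0)
    (f : Coloring V κ → ℝ≥0∞) :
    expect (withRandomAvailable C v next) f =
      ((available C v).card : ℝ≥0∞)⁻¹ * ∑ α ∈ available C v, expect (next α) f := by
  rw [withRandomAvailable, dif_pos (Finset.card_ne_zero.1 h), expect_bind, expect_uniformOfFinset]

end Expect

/-! ### The recoloring at the insertion of an edge -/

/-- The coloring `C` with the color of `uv` removed. -/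
noncomputable def unsetColor (C : Coloring V κ) (u v : V) : Coloring V κ :=
  fun f => by classical exact if f = s(u, v) then none else C f

section Insert

variable {G : SimpleGraph V} {C X Y : Coloring V κ} {p r w x y : V} {α β : Fin κ}

lemma unsetColor_self : unsetColor C p r s(p, r) = none := by simp [unsetColor]

lemma unsetColor_of_ne {f : Sym2 V} (h : f ≠ s(p, r)) : unsetColor C p r f = C f := by
  simp [unsetColor, h]

lemma unsetColor_setColor (h : C s(p, r) = none) : unsetColor (setColor C p r β) p r = C := by
  funext f
  by_cases hf : f = s(p, r)
  · rw [hf, unsetColor_self, h]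
  · rw [unsetColor_of_ne hf, setColor_of_ne hf]

lemma setColor_unsetColor (h : C s(p, r) = some β) : setColor (unsetColor C p r) p r β = C := by
  funext f
  by_cases hf : f = s(p, r)
  · rw [hf, setColor_self, h]
  · rw [setColor_of_ne hf, unsetColor_of_ne hf]

/-- A coloring is proper if it is so on both sides of the edge `pr`, and the color of this edge is
used neither at `r` on the one side nor at `p` on the other side. -/
lemma isProperEdgeColoring_of_sides (hG : G.IsAcyclic) (hadj : G.Adj p r)
    (hY : IsSupportedOn G Y) (h1 : IsProperInside G (side G p r) Y)
    (h2 : IsProperInside G (side G p r)ᶜ Y) (hβ : Y s(p, r) = some β)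
    (hr : ∀ w ∈ side G p r, Y s(r, w) ≠ some β) (hp : ∀ w, w ∉ side G p r → Y s(p, w) ≠ some β) :
    IsProperEdgeColoring G Y := by
  refine ⟨hY, ?_⟩
  have hβ' : Y s(r, p) = some β := by rw [Sym2.eq_swap, hβ]
  have key : ∀ x y z, y ≠ z → G.Adj x y → G.Adj x z → (x ∈ side G p r ↔ y ∈ side G p r) →
      Y s(x, y) ≠ Y s(x, z) := by
    intro x y z hyz hxy hxz hiff
    by_cases hx : x ∈ side G p r
    · have hy := hiff.1 hx
      by_cases hz : z ∈ side G p r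
      · exact h1 x hx y hy z hz hyz hxy hxz
      · obtain ⟨rfl, rfl⟩ := eq_of_adj_of_mem_side hG hadj hx hxz hz
        rw [hβ']
        exact hr y hy
    · have hy := fun h => hx (hiff.2 h)
      by_cases hz : z ∈ side G p r
      · obtain ⟨rfl, rfl⟩ := eq_of_adj_of_mem_side hG hadj hz hxz.symm hx
        rw [hβ]
        exact hp y hy
      · exact h2 x hx y hy z hz hyz hxy hxz
  intro x y z hyz hxy hxz
  by_cases h : x ∈ side G p r ↔ y ∈ side G p r
  · exact key x y z hyz hxy hxz h
  · by_cases h' : x ∈ side G p r ↔ z ∈ side G p r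
    · exact (key x z y hyz.symm hxz hxy h').symm
    · -- the edges `xy` and `xz` cannot both connect the two sides
      exfalso
      apply hyz
      by_cases hx : x ∈ side G p r
      · have hy : y ∉ side G p r := by tauto
        have hz : z ∉ side G p r := by tauto
        rw [(eq_of_adj_of_mem_side hG hadj hx hxy hy).2, (eq_of_adj_of_mem_side hG hadj hx hxz hz).2]
      · have hy : y ∈ side G p r := by tauto
        have hz : z ∈ side G p r := by tauto
        rw [(eq_of_adj_of_mem_side hG hadj hy hxy.symm hx).1,
          (eq_of_adj_of_mem_side hG hadj hz hxz.symm hx).1]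

/-- The graph `G` with the edge `pr`. -/
abbrev addEdge (G : SimpleGraph V) (p r : V) : SimpleGraph V := G ⊔ SimpleGraph.edge p r

lemma addEdge_adj (hne : p ≠ r) :
    (addEdge G p r).Adj x y ↔ G.Adj x y ∨ s(x, y) = s(p, r) := by
  simp only [addEdge, SimpleGraph.sup_adj, SimpleGraph.edge_adj, Sym2.eq_iff]
  constructor
  · tauto
  · rintro (h | ⟨rfl, rfl⟩ | ⟨rfl, rfl⟩)
    · exact Or.inl h
    · exact Or.inr ⟨Or.inl ⟨rfl, rfl⟩, hne⟩
    · exact Or.inr ⟨Or.inr ⟨rfl, rfl⟩, hne.symm⟩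

lemma mem_edgeSet_addEdge (hne : p ≠ r) (f : Sym2 V) :
    f ∈ (addEdge G p r).edgeSet ↔ f ∈ G.edgeSet ∨ f = s(p, r) := by
  induction f using Sym2.ind with
  | _ x y => exact addEdge_adj hne

lemma ne_of_not_reachable (h : ¬ G.Reachable p r) : p ≠ r := by
  rintro rfl
  exact h (SimpleGraph.Reachable.refl _)

lemma side_addEdge (h : ¬ G.Reachable p r) :
    side (addEdge G p r) p r = {x | G.Reachable r x} := by
  have : (addEdge G p r).deleteEdges {s(p, r)} = G := by
    ext x y
    rw [SimpleGraph.deleteEdges_adj, addEdge_adj (ne_of_not_reachable h)]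
    simp only [Set.mem_singleton_iff]
    constructor
    · tauto
    · intro hxy
      refine ⟨Or.inl hxy, fun he => h ?_⟩
      have : s(p, r) ∈ G.edgeSet := he ▸ (SimpleGraph.mem_edgeSet _).2 hxy
      exact ((SimpleGraph.mem_edgeSet _).1 this).reachable
  rw [side, this]

lemma notMem_edgeSet_of_not_reachable (h : ¬ G.Reachable p r) : s(p, r) ∉ G.edgeSet :=
  fun he => h ((SimpleGraph.mem_edgeSet _).1 he).reachable

lemma addEdge_adj_self (h : ¬ G.Reachable p r) : (addEdge G p r).Adj p r :=
  (addEdge_adj (ne_of_not_reachable h)).2 (Or.inr rfl)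

lemma isAcyclic_addEdge (hG : G.IsAcyclic) (h : ¬ G.Reachable p r) : (addEdge G p r).IsAcyclic :=
  hG.sup_edge_of_not_reachable h

lemma ncard_neighborSet_addEdge [Finite V] (h : ¬ G.Reachable p r) :
    ((addEdge G p r).neighborSet r).ncard = (G.neighborSet r).ncard + 1 := by
  have hne := ne_of_not_reachable h
  have : (addEdge G p r).neighborSet r = insert p (G.neighborSet r) := by
    ext w
    simp only [SimpleGraph.mem_neighborSet, Set.mem_insert_iff]
    rw [addEdge_adj hne]
    simp only [Sym2.eq_iff, hne.symm, false_and, true_and, false_or]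
    tauto
  rw [this, Set.ncard_insert_of_notMem]
  intro hp
  exact h ((SimpleGraph.mem_neighborSet _ _ _).1 hp).symm.reachable

/-- The new edge is not colored before its insertion. -/
lemma color_eq_none (hC : IsSupportedOn G C) (h : ¬ G.Reachable p r) : C s(p, r) = none := by
  by_contra hne
  exact notMem_edgeSet_of_not_reachable h ((hC _).1 hne)

lemma setColor_isSupportedOn (hC : IsSupportedOn G C) (h : ¬ G.Reachable p r) :
    IsSupportedOn (addEdge G p r) (setColor C p r β) := by
  intro f
  rw [mem_edgeSet_addEdge (ne_of_not_reachable h), ← hC f]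
  by_cases hf : f = s(p, r)
  · subst hf
    simp [setColor_self]
  · simp [setColor_of_ne hf, hf]

/-- Removing the color of `pr` from a coloring that is proper on both sides of this edge. -/
lemma unsetColor_isProper (hY : IsSupportedOn (addEdge G p r) Y) (h : ¬ G.Reachable p r)
    (h1 : IsProperInside (addEdge G p r) {x | G.Reachable r x} Y)
    (h2 : IsProperInside (addEdge G p r) {x | G.Reachable r x}ᶜ Y) :
    IsProperEdgeColoring G (unsetColor Y p r) := by
  have hne := ne_of_not_reachable h
  have hGne : ∀ {f}, f ∈ G.edgeSet → f ≠ s(p, r) := by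
    rintro f hf rfl
    exact notMem_edgeSet_of_not_reachable h hf
  constructor
  · intro f
    by_cases hf : f = s(p, r)
    · subst hf
      simp [unsetColor_self, notMem_edgeSet_of_not_reachable h]
    · rw [unsetColor_of_ne hf, hY f, mem_edgeSet_addEdge hne]
      simp [hf]
  · intro x y z hyz hxy hxz
    rw [unsetColor_of_ne (hGne ((SimpleGraph.mem_edgeSet _).2 hxy)),
      unsetColor_of_ne (hGne ((SimpleGraph.mem_edgeSet _).2 hxz))]
    by_cases hx : G.Reachable r x
    · exact h1 x hx y (hx.trans hxy.reachable) z (hx.trans hxz.reachable) hyz (Or.inl hxy)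
        (Or.inl hxz)
    · exact h2 x hx y (fun hy => hx (hy.trans hxy.symm.reachable)) z
        (fun hz => hx (hz.trans hxz.symm.reachable)) hyz (Or.inl hxy) (Or.inl hxz)

/-- Coloring the new edge keeps both of its sides properly colored. -/
lemma setColor_isProperInside (hC : IsProperEdgeColoring G C) (h : ¬ G.Reachable p r)
    {S : Set V} (hS : p ∉ S ∨ r ∉ S) :
    IsProperInside (addEdge G p r) S (setColor C p r β) := by
  intro x hx y hy z hz hyz hxy hxz
  have hne : ∀ {y}, y ∈ S → s(x, y) ≠ s(p, r) := by
    intro y hy he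
    rcases Sym2.eq_iff.1 he with ⟨rfl, rfl⟩ | ⟨rfl, rfl⟩ <;> tauto
  rw [addEdge_adj (ne_of_not_reachable h)] at hxy hxz
  rw [setColor_of_ne (hne hy), setColor_of_ne (hne hz)]
  exact hC.2 x y z hyz (hxy.resolve_right (hne hy)) (hxz.resolve_right (hne hz))

lemma color_setColor_child (hwp : w ≠ p) (hne : p ≠ r) :
    setColor C p r β s(r, w) = C s(r, w) := by
  refine setColor_of_ne fun he => ?_
  rcases Sym2.eq_iff.1 he with ⟨rfl, _⟩ | ⟨_, rfl⟩
  · exact hne rfl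
  · exact hwp rfl

lemma exists_child_iff (hC : IsSupportedOn G C) (h : ¬ G.Reachable p r) :
    (∃ w, w ≠ p ∧ setColor C p r β s(r, w) = some β) ↔ β ∉ available C r := by
  have hne := ne_of_not_reachable h
  rw [notMem_available]
  constructor
  · rintro ⟨w, hw, hc⟩
    exact ⟨w, by rwa [color_setColor_child hw hne] at hc⟩
  · rintro ⟨w, hc⟩
    have hw : w ≠ p := by
      rintro rfl
      exact h (hC.adj hc).symm.reachable
    exact ⟨w, hw, by rwa [color_setColor_child hw hne]⟩

lemma available_setColor (hC : IsSupportedOn G C) (h : ¬ G.Reachable p r)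
    (hβ : β ∉ available C r) : available (setColor C p r β) r = available C r := by
  have hne := ne_of_not_reachable h
  have hrp : C s(r, p) = none := by rw [Sym2.eq_swap, color_eq_none hC h]
  ext α
  rw [← not_iff_not, notMem_available, notMem_available]
  constructor
  · rintro ⟨w, hw⟩
    by_cases hwp : w = p
    · subst hwp
      rw [Sym2.eq_swap, setColor_self] at hw
      exact Option.some.inj hw ▸ notMem_available.1 hβ
    · exact ⟨w, by rwa [color_setColor_child hwp hne] at hw⟩
  · rintro ⟨w, hw⟩
    have hwp : w ≠ p := by
      rintro rfl
      simp [hrp] at hw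
    exact ⟨w, by rwa [color_setColor_child hwp hne]⟩

/-- The proper edge-colorings of `G` with `κ` colors. -/
noncomputable def properColorings [Finite V] (κ : ℕ) (G : SimpleGraph V) :
    Finset (Coloring V κ) :=
  (Set.toFinite {C | IsProperEdgeColoring G C}).toFinset

lemma mem_properColorings [Finite V] :
    C ∈ properColorings κ G ↔ IsProperEdgeColoring G C := by
  simp [properColorings]

/-- The effect of `fixForbidden` on the edges at its starting vertex. -/
lemma fixForbidden_color_child (hG : G.IsAcyclic) (k : ℕ) (hC : IsSupportedOn G C)
    (hP : IsProperInside G (side G p r) C) (hw : w ≠ p) (hc : C s(r, w) = some β) :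
    fixForbidden (k + 1) C p r α β s(r, w) = some α := by
  have hadj := hC.adj hc
  rw [fixForbidden_succ k hw hc (child_unique hC hP hw hc),
    fixForbidden_outside hG k (hC.setColor hadj)
      (not_inside_of_left (parent_notMem_side hG hadj)), setColor_self]

variable [Fintype V]

lemma ncard_le_card (S : Set V) : S.ncard ≤ Fintype.card V := by
  rw [← Nat.card_eq_fintype_card, ← Set.ncard_univ]
  exact Set.ncard_le_ncard (Set.subset_univ _) (Set.toFinite _)

/-- If the color of the new edge is available at both ends, then inserting it is a bijection. -/
lemma sum_setColor_eq (h : ¬ G.Reachable p r) (hG : G.IsAcyclic) (β : Fin κ)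
    (F : Coloring V κ → ℝ≥0∞) :
    ∑ C ∈ (properColorings κ G).filter (fun C => β ∈ available C p ∧ β ∈ available C r),
        F (setColor C p r β) =
      ∑ C ∈ (properColorings κ (addEdge G p r)).filter (fun C => C s(p, r) = some β), F C := by
  have hne := ne_of_not_reachable h
  have hG' := isAcyclic_addEdge hG h
  have hadj := addEdge_adj_self h
  have hside := side_addEdge h
  refine Finset.sum_nbij' (fun C => setColor C p r β) (fun C => unsetColor C p r) ?_ ?_ ?_ ?_ ?_
  · intro C hC
    obtain ⟨hC, hβp, hβr⟩ := Finset.mem_filter.1 hC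
    rw [mem_properColorings] at hC
    rw [mem_available] at hβp hβr
    refine Finset.mem_filter.2 ⟨mem_properColorings.2 ?_, setColor_self⟩
    refine isProperEdgeColoring_of_sides hG' hadj (setColor_isSupportedOn hC.isSupportedOn h)
      (setColor_isProperInside hC h (by simp [hside, SimpleGraph.reachable_comm, h]))
      (setColor_isProperInside hC h (by simp [hside])) setColor_self ?_ ?_
    · intro w hw
      rw [color_setColor_child _ hne]
      · exact hβr w
      · rintro rfl
        exact parent_notMem_side hG' hadj hw
    · intro w hw
      rw [setColor_of_ne]
      · exact hβp w
      · intro he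
        rcases Sym2.eq_iff.1 he with ⟨_, rfl⟩ | ⟨rfl, _⟩
        · exact hw self_mem_side
        · exact hne rfl
  · intro C hC
    obtain ⟨hC, hβ⟩ := Finset.mem_filter.1 hC
    rw [mem_properColorings] at hC
    refine Finset.mem_filter.2 ⟨mem_properColorings.2 (unsetColor_isProper hC.isSupportedOn h
      (hC.isProperInside _) (hC.isProperInside _)), ?_, ?_⟩
    · rw [mem_available]
      intro w hw
      by_cases hwr : w = r
      · subst hwr
        simp [unsetColor_self] at hw
      · rw [unsetColor_of_ne (by simp [hwr, hne])] at hw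
        exact hwr (hC.eq_of_color_eq hβ hw)
    · rw [mem_available]
      intro w hw
      rw [Sym2.eq_swap] at hβ
      by_cases hwp : w = p
      · subst hwp
        rw [Sym2.eq_swap, unsetColor_self] at hw
        simp at hw
      · rw [unsetColor_of_ne (by simp [hwp, hne.symm])] at hw
        exact hwp (hC.eq_of_color_eq hβ hw)
  · intro C hC
    obtain ⟨hC, -, -⟩ := Finset.mem_filter.1 hC
    exact unsetColor_setColor (color_eq_none (mem_properColorings.1 hC).isSupportedOn h)
  · intro C hC
    exact setColor_unsetColor (Finset.mem_filter.1 hC).2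
  · intro C hC
    rfl

/-- If the color `β` of the new edge is used at its lower end `r`, then for each color `α` available
at `r`, the recoloring is a bijection to the proper colorings of the new forest for which the new
edge has the color `β` and another edge at `r` has the color `α`. -/
lemma sum_fixForbidden_eq (h : ¬ G.Reachable p r) (hG : G.IsAcyclic) (α β : Fin κ) (k : ℕ)
    (hk : Fintype.card V ≤ k + 1) (F : Coloring V κ → ℝ≥0∞) :
    ∑ C ∈ (properColorings κ G).filter
        (fun C => β ∈ available C p ∧ β ∉ available C r ∧ α ∈ available C r),
        F (fixForbidden (k + 1) (setColor C p r β) p r α β) =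
      ∑ C ∈ (properColorings κ (addEdge G p r)).filter
        (fun C => C s(p, r) = some β ∧ α ∉ available C r ∧ α ≠ β), F C := by
  have hne := ne_of_not_reachable h
  have hG' := isAcyclic_addEdge hG h
  have hadj := addEdge_adj_self h
  have hside := side_addEdge h
  have hp := parent_notMem_side hG' hadj
  have hk' := (ncard_le_card (side (addEdge G p r) p r)).trans hk
  -- what is known about a coloring on the left hand side after the new edge has been colored
  have key : ∀ C ∈ (properColorings κ G).filter
      (fun C => β ∈ available C p ∧ β ∉ available C r ∧ α ∈ available C r),
      IsProperEdgeColoring G C ∧ α ≠ β ∧ IsSupportedOn (addEdge G p r) (setColor C p r β) ∧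
      IsProperInside (addEdge G p r) (side (addEdge G p r) p r) (setColor C p r β) ∧
      ∀ w ∈ side (addEdge G p r) p r, setColor C p r β s(r, w) ≠ some α := by
    intro C hC
    obtain ⟨hC, -, hβr, hαr⟩ := Finset.mem_filter.1 hC
    rw [mem_properColorings] at hC
    refine ⟨hC, fun hh => hβr (hh ▸ hαr), setColor_isSupportedOn hC.isSupportedOn h,
      setColor_isProperInside hC h (Or.inl hp), fun w hw => ?_⟩
    have hwp : w ≠ p := by
      rintro rfl
      exact hp hw
    rw [color_setColor_child hwp hne]
    exact mem_available.1 hαr w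
  -- what is known about a coloring on the right hand side
  have key' : ∀ C ∈ (properColorings κ (addEdge G p r)).filter
      (fun C => C s(p, r) = some β ∧ α ∉ available C r ∧ α ≠ β),
      IsProperEdgeColoring (addEdge G p r) C ∧
      ∀ w ∈ side (addEdge G p r) p r, C s(r, w) ≠ some β := by
    intro C hC
    obtain ⟨hC, hβ, -, -⟩ := Finset.mem_filter.1 hC
    rw [mem_properColorings] at hC
    refine ⟨hC, fun w hw hc => hp ?_⟩
    rw [Sym2.eq_swap] at hβ
    rwa [hC.eq_of_color_eq hβ hc] at hw
  have hpr : ¬ ∀ x ∈ s(p, r), x ∈ side (addEdge G p r) p r := not_inside_of_left hp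
  refine Finset.sum_nbij' (fun C => fixForbidden (k + 1) (setColor C p r β) p r α β)
    (fun C => unsetColor (fixForbidden (k + 1) C p r β α) p r) ?_ ?_ ?_ ?_ ?_
  · intro C hCm
    obtain ⟨hC, hαβ, hX, hP, hα⟩ := key C hCm
    obtain ⟨-, hβp, hβr, hαr⟩ := Finset.mem_filter.1 hCm
    obtain ⟨h1, h2⟩ := fixForbidden_isProperInside hG' (k + 1) hX hαβ hP hα hk'
    have hY : fixForbidden (k + 1) (setColor C p r β) p r α β s(p, r) = some β := by
      rw [fixForbidden_outside hG' _ hX hpr, setColor_self]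
    refine Finset.mem_filter.2 ⟨mem_properColorings.2 ?_, hY, ?_, hαβ⟩
    · refine isProperEdgeColoring_of_sides hG' hadj (fixForbidden_supported _ hX) h1 ?_ hY h2 ?_
      · intro x hx y hy z hz hyz hxy hxz
        rw [fixForbidden_outside hG' _ hX (not_inside_of_left hx),
          fixForbidden_outside hG' _ hX (not_inside_of_left hx)]
        exact setColor_isProperInside hC h (S := (side (addEdge G p r) p r)ᶜ)
          (Or.inr fun hh => hh self_mem_side) x hx y hy z hz hyz hxy hxz
      · intro w hw
        rw [fixForbidden_outside hG' _ hX (not_inside_of_left hp), setColor_of_ne]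
        · exact mem_available.1 hβp w
        · intro he
          rcases Sym2.eq_iff.1 he with ⟨_, rfl⟩ | ⟨rfl, _⟩
          · exact hw self_mem_side
          · exact hne rfl
    · obtain ⟨w, hw, hc⟩ := (exists_child_iff hC.isSupportedOn h).2 hβr
      exact notMem_available.2 ⟨w, fixForbidden_color_child hG' k hX hP hw hc⟩
  · intro C hCm
    obtain ⟨hC, hβr⟩ := key' C hCm
    obtain ⟨-, hβ, hα, hαβ⟩ := Finset.mem_filter.1 hCm
    have hP := hC.isProperInside (side (addEdge G p r) p r)
    have hS := hC.isSupportedOn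
    obtain ⟨h1, h2⟩ := fixForbidden_isProperInside hG' (k + 1) hS hαβ.symm hP hβr hk'
    refine Finset.mem_filter.2 ⟨mem_properColorings.2 ?_, ?_, ?_, ?_⟩
    · refine unsetColor_isProper (fixForbidden_supported _ hS) h (by rwa [← hside]) ?_
      rw [← hside]
      intro x hx y hy z hz hyz hxy hxz
      rw [fixForbidden_outside hG' _ hS (not_inside_of_left hx),
        fixForbidden_outside hG' _ hS (not_inside_of_left hx)]
      exact hC.2 x y z hyz hxy hxz
    · rw [mem_available]
      intro w hw
      by_cases hwr : w = r
      · subst hwr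
        simp [unsetColor_self] at hw
      · rw [unsetColor_of_ne (by simp [hwr, hne]),
          fixForbidden_outside hG' _ hS (not_inside_of_left hp)] at hw
        exact hwr (hC.eq_of_color_eq hβ hw)
    · obtain ⟨w, hc⟩ := notMem_available.1 hα
      have hwp : w ≠ p := by
        rintro rfl
        rw [Sym2.eq_swap, hβ] at hc
        exact hαβ (Option.some.inj hc).symm
      refine notMem_available.2 ⟨w, ?_⟩
      rw [unsetColor_of_ne (by simp [hwp, hne.symm])]
      exact fixForbidden_color_child hG' k hS hP hwp hc
    · rw [mem_available]
      intro w hw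
      by_cases hwp : w = p
      · subst hwp
        rw [Sym2.eq_swap, unsetColor_self] at hw
        simp at hw
      · rw [unsetColor_of_ne (by simp [hwp, hne.symm])] at hw
        exact h2 w (child_mem_side ((fixForbidden_supported _ hS).adj hw) hwp) hw
  · intro C hCm
    obtain ⟨hC, hαβ, hX, hP, hα⟩ := key C hCm
    rw [fixForbidden_fixForbidden hG' (k + 1) hX hadj hαβ hP hα,
      unsetColor_setColor (color_eq_none hC.isSupportedOn h)]
  · intro C hCm
    obtain ⟨hC, hβr⟩ := key' C hCm
    obtain ⟨-, hβ, hα, hαβ⟩ := Finset.mem_filter.1 hCm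
    rw [setColor_unsetColor]
    · exact fixForbidden_fixForbidden hG' (k + 1) hC.isSupportedOn hadj hαβ.symm
        (hC.isProperInside _) hβr
    · rw [fixForbidden_outside hG' _ hC.isSupportedOn hpr, hβ]
  · intro C _
    rfl

end Insert

/-! ### The law of the coloring is uniform -/

section Uniform

section

variable {Δ : ℕ} {e : ℕ → V × V} {m t : ℕ}

lemma orient_eq_or (G : SimpleGraph V) (b : Bool) (u v : V) :
    orient Δ G b u v = (u, v) ∨ orient Δ G b u v = (v, u) := by
  rw [orient]
  split_ifs <;> simp

variable {tie : ℕ → Bool}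

/-- The parent of the new edge at the insertion `t`. -/
noncomputable def parentAt (Δ : ℕ) (e : ℕ → V × V) (tie : ℕ → Bool) (t : ℕ) : V :=
  (orient Δ (forestAt e t) (tie t) (e t).1 (e t).2).1

/-- The child of the new edge at the insertion `t`. -/
noncomputable def childAt (Δ : ℕ) (e : ℕ → V × V) (tie : ℕ → Bool) (t : ℕ) : V :=
  (orient Δ (forestAt e t) (tie t) (e t).1 (e t).2).2

lemma parentAt_childAt_eq_or : (parentAt Δ e tie t = (e t).1 ∧ childAt Δ e tie t = (e t).2) ∨
    (parentAt Δ e tie t = (e t).2 ∧ childAt Δ e tie t = (e t).1) := by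
  rcases orient_eq_or (Δ := Δ) (forestAt e t) (tie t) (e t).1 (e t).2 with h | h <;>
    simp [parentAt, childAt, h]

lemma forestAt_succ_eq :
    forestAt e (t + 1) = addEdge (forestAt e t) (parentAt Δ e tie t) (childAt Δ e tie t) := by
  rcases parentAt_childAt_eq_or (Δ := Δ) (e := e) (tie := tie) (t := t) with ⟨h, h'⟩ | ⟨h, h'⟩
  · rw [h, h']
    rfl
  · rw [h, h', addEdge, SimpleGraph.edge_comm]
    rfl

lemma not_reachable_parentAt_childAt (he : IsInsertionSequence Δ e m) (ht : t < m) :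
    ¬ (forestAt e t).Reachable (parentAt Δ e tie t) (childAt Δ e tie t) := by
  rcases parentAt_childAt_eq_or (Δ := Δ) (e := e) (tie := tie) (t := t) with ⟨h, h'⟩ | ⟨h, h'⟩
  · rw [h, h']
    exact he.1 t ht
  · rw [h, h', SimpleGraph.reachable_comm]
    exact he.1 t ht

lemma isAcyclic_forestAt (he : IsInsertionSequence Δ e m) (ht : t ≤ m) :
    (forestAt e t).IsAcyclic := by
  induction t with
  | zero => exact SimpleGraph.isAcyclic_bot
  | succ t ih => exact isAcyclic_addEdge (ih (by omega)) (he.1 t (by omega))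

end

variable [Fintype V] {G : SimpleGraph V} {C : Coloring V κ} {p r : V} {α β : Fin κ}

/-- The insertion of the edge between a new parent `p` and a new child `r`. -/
noncomputable def insertBelow (C : Coloring V κ) (p r : V) : PMF (Coloring V κ) :=
  withRandomAvailable C p fun β => rootToChild (setColor C p r β) p r β

lemma card_available (hC : IsProperEdgeColoring G C) (v : V) :
    (available C v).card = κ - (G.neighborSet v).ncard := by
  have := card_available_add hC v
  omega

open Classical in
lemma expect_rootToChild (hC : IsProperEdgeColoring G C) (h : ¬ G.Reachable p r)
    (hr : (G.neighborSet r).ncard < κ) (F : Coloring V κ → ℝ≥0∞) :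
    expect (rootToChild (setColor C p r β) p r β) F =
      if β ∈ available C r then F (setColor C p r β) else
        ((κ - (G.neighborSet r).ncard : ℕ) : ℝ≥0∞)⁻¹ * ∑ α ∈ available C r,
          F (fixForbidden (Fintype.card V + 1) (setColor C p r β) p r α β) := by
  by_cases hβ : β ∈ available C r
  · rw [if_pos hβ, rootToChild, dif_neg, expect_pure]
    rw [exists_child_iff hC.isSupportedOn h]
    exact not_not.2 hβ
  · have hex := (exists_child_iff (β := β) hC.isSupportedOn h).2 hβ
    have hav := available_setColor hC.isSupportedOn h hβ
    have hcard := card_available hC r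
    rw [if_neg hβ, rootToChild, dif_pos hex, expect_withRandomAvailable, hav, hcard]
    · congr 1
      refine Finset.sum_congr rfl fun α _ => ?_
      rw [expect_pure, fixForbidden, dif_pos hex]
    · rw [hav, hcard]
      omega

lemma expect_insertBelow (hC : IsProperEdgeColoring G C)
    (hp : (G.neighborSet p).ncard < κ) (F : Coloring V κ → ℝ≥0∞) :
    expect (insertBelow C p r) F = ((κ - (G.neighborSet p).ncard : ℕ) : ℝ≥0∞)⁻¹ *
      ∑ β ∈ available C p, expect (rootToChild (setColor C p r β) p r β) F := by
  have hcard := card_available hC p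
  rw [insertBelow, expect_withRandomAvailable _ _ _ (by omega), hcard]

open Classical in
/-- Summation over the colorings whose color of the new edge is `β`. The first summand stems from
the colorings for which `β` is available at `r`, the second one from those for which the chain is
recolored; every proper coloring of the new forest arises in the second way once for every
other color at `r`. -/
lemma sum_expect_rootToChild (hG : G.IsAcyclic) (h : ¬ G.Reachable p r)
    (hr : (G.neighborSet r).ncard < κ) (β : Fin κ) (F : Coloring V κ → ℝ≥0∞) :
    ∑ C ∈ (properColorings κ G).filter (fun C => β ∈ available C p),
        expect (rootToChild (setColor C p r β) p r β) F =
      (1 + ((κ - (G.neighborSet r).ncard : ℕ) : ℝ≥0∞)⁻¹ * (G.neighborSet r).ncard) *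
      ∑ C ∈ (properColorings κ (addEdge G p r)).filter (fun C => C s(p, r) = some β), F C := by
  set q : ℝ≥0∞ := ((κ - (G.neighborSet r).ncard : ℕ) : ℝ≥0∞)⁻¹ with hq
  calc ∑ C ∈ (properColorings κ G).filter (fun C => β ∈ available C p),
        expect (rootToChild (setColor C p r β) p r β) F
      = ∑ C ∈ (properColorings κ G).filter (fun C => β ∈ available C p),
          if β ∈ available C r then F (setColor C p r β) else q * ∑ α ∈ available C r,
            F (fixForbidden (Fintype.card V + 1) (setColor C p r β) p r α β) := by
        refine Finset.sum_congr rfl fun C hC => ?_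
        exact expect_rootToChild (mem_properColorings.1 (Finset.mem_filter.1 hC).1) h hr F
    _ = ∑ C ∈ (properColorings κ G).filter (fun C => β ∈ available C p ∧ β ∈ available C r),
          F (setColor C p r β) + q * ∑ α, ∑ C ∈ (properColorings κ G).filter
            (fun C => β ∈ available C p ∧ β ∉ available C r ∧ α ∈ available C r),
            F (fixForbidden (Fintype.card V + 1) (setColor C p r β) p r α β) := by
        rw [Finset.sum_ite, Finset.filter_filter, Finset.filter_filter]
        congr 1
        rw [← Finset.mul_sum]
        congr 1
        simp only [← and_assoc]
        have h1 : ∀ C : Coloring V κ, ∑ α ∈ available C r,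
            F (fixForbidden (Fintype.card V + 1) (setColor C p r β) p r α β) =
            ∑ α, if α ∈ available C r then
              F (fixForbidden (Fintype.card V + 1) (setColor C p r β) p r α β) else 0 := by
          intro C
          rw [← Finset.sum_filter]
          congr 1
          ext
          simp
        simp only [h1]
        rw [Finset.sum_comm]
        refine Finset.sum_congr rfl fun α _ => ?_
        rw [← Finset.sum_filter, Finset.filter_filter]
    _ = ∑ C ∈ (properColorings κ (addEdge G p r)).filter (fun C => C s(p, r) = some β), F C +
          q * ∑ α, ∑ C ∈ (properColorings κ (addEdge G p r)).filter
            (fun C => C s(p, r) = some β ∧ α ∉ available C r ∧ α ≠ β), F C := by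
        rw [sum_setColor_eq h hG]
        simp only [sum_fixForbidden_eq h hG _ β (Fintype.card V) (Nat.le_succ _)]
    _ = _ := by
        rw [add_mul, one_mul, mul_assoc]
        congr 2
        have h0 : ∀ α, ∑ C ∈ (properColorings κ (addEdge G p r)).filter
            (fun C => C s(p, r) = some β ∧ α ∉ available C r ∧ α ≠ β), F C =
            ∑ C ∈ (properColorings κ (addEdge G p r)).filter (fun C => C s(p, r) = some β),
              if α ∉ available C r ∧ α ≠ β then F C else 0 := by
          intro α
          rw [← Finset.sum_filter, Finset.filter_filter]
        simp only [h0]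
        rw [Finset.sum_comm, Finset.mul_sum]
        refine Finset.sum_congr rfl fun C hC => ?_
        obtain ⟨hC, hβ⟩ := Finset.mem_filter.1 hC
        rw [mem_properColorings] at hC
        rw [← Finset.sum_filter, Finset.sum_const, nsmul_eq_mul]
        congr 2
        have h1 : (Finset.univ.filter fun α => α ∉ available C r ∧ α ≠ β) =
            ((available C r)ᶜ).erase β := by
          ext α
          simp [and_comm]
        have h2 : β ∈ (available C r)ᶜ := by
          rw [Finset.mem_compl, notMem_available]
          exact ⟨p, by rw [Sym2.eq_swap, hβ]⟩
        have h3 := card_available_add hC r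
        rw [ncard_neighborSet_addEdge h] at h3
        rw [h1, Finset.card_erase_of_mem h2, Finset.card_compl, Fintype.card_fin]
        omega

open Classical in
/-- The insertion of an edge pushes the counting measure on the proper colorings forward to a
multiple of the counting measure. -/
lemma sum_expect_insertBelow (hG : G.IsAcyclic) (h : ¬ G.Reachable p r)
    (hp : (G.neighborSet p).ncard < κ) (hr : (G.neighborSet r).ncard < κ)
    (F : Coloring V κ → ℝ≥0∞) :
    ∑ C ∈ properColorings κ G, expect (insertBelow C p r) F =
      (((κ - (G.neighborSet p).ncard : ℕ) : ℝ≥0∞)⁻¹ *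
        (1 + ((κ - (G.neighborSet r).ncard : ℕ) : ℝ≥0∞)⁻¹ * (G.neighborSet r).ncard)) *
      ∑ C ∈ properColorings κ (addEdge G p r), F C := by
  rw [Finset.sum_congr rfl fun C hC => expect_insertBelow (mem_properColorings.1 hC) hp F,
    ← Finset.mul_sum, mul_assoc]
  congr 1
  have h1 : ∀ C : Coloring V κ, ∑ β ∈ available C p,
      expect (rootToChild (setColor C p r β) p r β) F = ∑ β, if β ∈ available C p then
        expect (rootToChild (setColor C p r β) p r β) F else 0 := by
    intro C
    rw [← Finset.sum_filter]
    congr 1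
    ext
    simp
  simp only [h1]
  rw [Finset.sum_comm]
  simp only [← Finset.sum_filter, sum_expect_rootToChild hG h hr]
  rw [← Finset.mul_sum]
  congr 1
  simp only [Finset.sum_filter]
  rw [Finset.sum_comm]
  refine Finset.sum_congr rfl fun C hC => ?_
  have hC := mem_properColorings.1 hC
  obtain ⟨β, hβ⟩ := Option.ne_none_iff_exists'.1
    ((hC.1 s(p, r)).2 ((SimpleGraph.mem_edgeSet _).2 (addEdge_adj_self h)))
  rw [Finset.sum_eq_single β]
  · rw [if_pos hβ]
  · intro b _ hb
    rw [if_neg]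
    rw [hβ]
    exact fun hh => hb (Option.some.inj hh).symm
  · simp

variable {Δ : ℕ} {e : ℕ → V × V} {tie : ℕ → Bool} {m t : ℕ}

lemma insertEdge_eq (G : SimpleGraph V) (b : Bool) (u v : V) (C : Coloring V κ) :
    insertEdge Δ G b u v C = insertBelow C (orient Δ G b u v).1 (orient Δ G b u v).2 := rfl

lemma degree_childAt_lt (he : IsInsertionSequence Δ e m) (ht : t < m) :
    ((forestAt e t).neighborSet (childAt Δ e tie t)).ncard < Δ := by
  have h1 := he.2 (t + 1) ht (childAt Δ e tie t)
  rw [forestAt_succ_eq (Δ := Δ) (tie := tie),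
    ncard_neighborSet_addEdge (not_reachable_parentAt_childAt he ht)] at h1
  omega

lemma degree_parentAt_lt (he : IsInsertionSequence Δ e m) (ht : t < m) :
    ((forestAt e t).neighborSet (parentAt Δ e tie t)).ncard < Δ := by
  have h1 := he.2 (t + 1) ht (parentAt Δ e tie t)
  rw [forestAt_succ_eq (Δ := Δ) (tie := tie), addEdge, SimpleGraph.edge_comm] at h1
  rw [ncard_neighborSet_addEdge
    (fun h => not_reachable_parentAt_childAt (tie := tie) he ht h.symm)] at h1
  omega

lemma expect_run_succ (f : Coloring V κ × ℕ → ℝ≥0∞) :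
    expect (run Δ κ e tie (t + 1)) f = expect (run Δ κ e tie t) fun s =>
      expect (insertBelow s.1 (parentAt Δ e tie t) (childAt Δ e tie t)) fun C' =>
        f (C', s.2 + recourse s.1 C') := by
  rw [run, expect_bind]
  simp only [expect_map, insertEdge_eq]
  rfl

lemma expect_coloringLaw (F : Coloring V κ → ℝ≥0∞) :
    expect (coloringLaw Δ κ e tie t) F = expect (run Δ κ e tie t) fun s => F s.1 :=
  expect_map _ _ _

lemma expect_coloringLaw_succ (F : Coloring V κ → ℝ≥0∞) :
    expect (coloringLaw Δ κ e tie (t + 1)) F = expect (coloringLaw Δ κ e tie t) fun C =>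
      expect (insertBelow C (parentAt Δ e tie t) (childAt Δ e tie t)) F := by
  rw [expect_coloringLaw, expect_run_succ, expect_coloringLaw]

/-- After each insertion, the coloring is uniformly distributed over the proper colorings. -/
lemma expect_coloringLaw_eq (he : IsInsertionSequence Δ e m) (hκ : Δ ≤ κ) (ht : t ≤ m) :
    (properColorings κ (forestAt e t)).card ≠ 0 ∧ ∀ F : Coloring V κ → ℝ≥0∞,
      expect (coloringLaw Δ κ e tie t) F = ((properColorings κ (forestAt e t)).card : ℝ≥0∞)⁻¹ *
        ∑ C ∈ properColorings κ (forestAt e t), F C := by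
  induction t with
  | zero =>
    have h0 : properColorings κ (forestAt e 0) = {fun _ => none} := by
      ext C
      rw [mem_properColorings, Finset.mem_singleton]
      constructor
      · intro hC
        funext f
        by_contra hf
        simpa [forestAt] using (hC.1 f).1 hf
      · rintro rfl
        exact ⟨by simp [forestAt], fun u v w _ h => absurd h (by simp [forestAt])⟩
    rw [h0]
    refine ⟨by simp, fun F => ?_⟩
    rw [expect_coloringLaw, run, expect_pure]
    simp
  | succ t ih =>
    obtain ⟨hN, hF⟩ := ih (by omega)
    have hsum := sum_expect_insertBelow (κ := κ) (isAcyclic_forestAt he (t := t) (by omega))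
      (not_reachable_parentAt_childAt (tie := tie) he ht)
      ((degree_parentAt_lt he ht).trans_le hκ) ((degree_childAt_lt he ht).trans_le hκ)
    rw [← forestAt_succ_eq] at hsum
    generalize ((κ - ((forestAt e t).neighborSet (parentAt Δ e tie t)).ncard : ℕ) : ℝ≥0∞)⁻¹ * (1 +
      ((κ - ((forestAt e t).neighborSet (childAt Δ e tie t)).ncard : ℕ) : ℝ≥0∞)⁻¹ *
        ((forestAt e t).neighborSet (childAt Δ e tie t)).ncard) = K at hsum
    have hone := hsum fun _ => 1
    simp only [expect_const, Finset.sum_const, nsmul_eq_mul, mul_one] at hone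
    have hN' : (properColorings κ (forestAt e (t + 1))).card ≠ 0 := by
      intro h0
      rw [h0] at hone
      simp at hone
      exact hN (by simpa using hone)
    refine ⟨hN', fun F => ?_⟩
    rw [expect_coloringLaw_succ, hF, hsum, ← mul_assoc]
    congr 1
    have hK : K ≠ 0 := by
      rintro rfl
      simp at hone
      exact hN (by simpa using hone)
    have hK' : K ≠ ⊤ := by
      rintro rfl
      rw [ENNReal.top_mul (by exact_mod_cast hN')] at hone
      exact ENNReal.natCast_ne_top _ hone
    rw [hone, ENNReal.mul_inv (Or.inl hK) (Or.inl hK'), mul_right_comm,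
      ENNReal.inv_mul_cancel hK hK', one_mul]

lemma ncard_setOf_isProperEdgeColoring :
    {C : Coloring V κ | IsProperEdgeColoring G C}.ncard = (properColorings κ G).card :=
  Set.ncard_eq_toFinset_card _ _

lemma coloringLaw_apply (he : IsInsertionSequence Δ e m) (hκ : Δ ≤ κ) (ht : t ≤ m)
    (C : Coloring V κ) :
    (IsProperEdgeColoring (forestAt e t) C → coloringLaw Δ κ e tie t C =
      ({C' : Coloring V κ | IsProperEdgeColoring (forestAt e t) C'}.ncard : ℝ≥0∞)⁻¹) ∧
    (¬ IsProperEdgeColoring (forestAt e t) C → coloringLaw Δ κ e tie t C = 0) := by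
  classical
  have h1 := (expect_coloringLaw_eq (tie := tie) he hκ ht).2 fun C' => if C' = C then 1 else 0
  have h2 : (expect (coloringLaw Δ κ e tie t) fun C' => if C' = C then 1 else 0) =
      coloringLaw Δ κ e tie t C := by
    rw [expect, tsum_eq_single C]
    · simp
    · intro C' hC'
      simp [hC']
  rw [h2, Finset.sum_ite_eq'] at h1
  rw [h1, ncard_setOf_isProperEdgeColoring]
  simp only [mem_properColorings]
  constructor
  · intro h
    simp [h]
  · intro h
    simp [h]

end Uniform

/-! ### The expected recourse of one insertion -/

section Cost

variable {G : SimpleGraph V} {C : Coloring V κ} {p r w : V} {α β : Fin κ}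

lemma recourse_setColor (hC : IsSupportedOn G C) (h : ¬ G.Reachable p r) :
    recourse C (setColor C p r β) = 0 := by
  rw [recourse]
  convert Set.ncard_empty (Sym2 V)
  ext f
  simp only [Set.mem_ofPred_eq, Set.mem_empty_iff_false, iff_false]
  rintro ⟨h1, h2⟩
  by_cases hf : f = s(p, r)
  · exact h1 (hf ▸ color_eq_none hC h)
  · exact h2 (setColor_of_ne hf)

variable [Fintype V]

lemma recourse_fixForbidden (hG : G.IsAcyclic) (hC : IsProperEdgeColoring G C)
    (h : ¬ G.Reachable p r) (k : ℕ) (hβ : β ∉ available C r) (hα : α ∈ available C r) :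
    recourse C (fixForbidden k (setColor C p r β) p r α β) = chainLength k C p r α β := by
  have hG' := isAcyclic_addEdge hG h
  have hp := parent_notMem_side hG' (addEdge_adj_self h)
  have hX := setColor_isSupportedOn (β := β) hC.isSupportedOn h
  have hαβ : α ≠ β := fun hh => hβ (hh ▸ hα)
  have hnew : ∀ f : Sym2 V, (∀ x ∈ f, x ∈ side (addEdge G p r) p r) → f ≠ s(p, r) := by
    rintro f hf rfl
    exact not_inside_of_left hp hf
  rw [chainLength_congr (C' := setColor C p r β) hG' k (fun _ _ _ h' => Or.inl
      (hC.isSupportedOn.adj h')) (fun _ _ _ h' => hX.adj h')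
      fun f hf => (setColor_of_ne (hnew f hf)).symm,
    ← ncard_fixForbidden_ne hG' k hX hαβ (setColor_isProperInside hC h (Or.inl hp)), recourse]
  congr 1
  ext f
  simp only [Set.mem_ofPred_eq]
  by_cases hf : f = s(p, r)
  · subst hf
    rw [fixForbidden_outside hG' k hX (not_inside_of_left hp)]
    simp [color_eq_none hC.isSupportedOn h]
  · rw [setColor_of_ne hf]
    refine and_iff_right_of_imp fun hne hnone => hne ?_
    have h1 : f ∉ (addEdge G p r).edgeSet := by
      rw [mem_edgeSet_addEdge (ne_of_not_reachable h)]
      rintro (h' | h')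
      · exact (hC.1 f).2 h' hnone
      · exact hf h'
    have h2 := fixForbidden_supported k hX (p := p) (v := r) (a := α) (b := β)
    rw [hnone]
    by_contra h3
    exact h1 ((h2 f).1 h3)

/-- The total length of the alternating paths, over all colors that the insertion may choose. -/
noncomputable def sumChainLength (C : Coloring V κ) (p r : V) : ℕ :=
  ∑ β ∈ available C p, ∑ α ∈ available C r, chainLength (Fintype.card V + 1) C p r α β

lemma expect_recourse (hG : G.IsAcyclic) (hC : IsProperEdgeColoring G C)
    (h : ¬ G.Reachable p r) (hp : (G.neighborSet p).ncard < κ)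
    (hr : (G.neighborSet r).ncard < κ) :
    (expect (insertBelow C p r) fun C' => (recourse C C' : ℝ≥0∞)) =
      ((κ - (G.neighborSet p).ncard : ℕ) : ℝ≥0∞)⁻¹ *
        (((κ - (G.neighborSet r).ncard : ℕ) : ℝ≥0∞)⁻¹ * (sumChainLength C p r : ℝ≥0∞)) := by
  rw [expect_insertBelow hC hp]
  congr 1
  rw [sumChainLength, Nat.cast_sum, Finset.mul_sum]
  refine Finset.sum_congr rfl fun β _ => ?_
  rw [expect_rootToChild hC h hr, Nat.cast_sum]
  split_ifs with hβ
  · rw [recourse_setColor hC.isSupportedOn h, Nat.cast_zero, Finset.sum_eq_zero, mul_zero]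
    intro α _
    rw [chainLength_of_not, Nat.cast_zero]
    rintro ⟨w, _, hw⟩
    exact mem_available.1 hβ w hw
  · congr 1
    refine Finset.sum_congr rfl fun α hα => ?_
    rw [recourse_fixForbidden hG hC h _ hβ hα]

/-- The expected recourse of the insertion of the edge between the parent `p` and the child `r`,
for a uniformly distributed proper coloring of `G`. -/
noncomputable def insertionCost (κ : ℕ) (G : SimpleGraph V) (p r : V) : ℝ :=
  ((∑ C ∈ properColorings κ G, sumChainLength C p r : ℕ) : ℝ) /
    ((properColorings κ G).card * ((κ - (G.neighborSet p).ncard : ℕ) : ℝ) *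
      ((κ - (G.neighborSet r).ncard : ℕ) : ℝ))

variable {Δ : ℕ} {e : ℕ → V × V} {tie : ℕ → Bool} {m t : ℕ}

lemma expect_total_recourse (he : IsInsertionSequence Δ e m) (hκ : Δ ≤ κ) (ht : t ≤ m) :
    (expect (run Δ κ e tie t) fun s => (s.2 : ℝ≥0∞)) =
      ∑ i ∈ Finset.range t, ENNReal.ofReal
        (insertionCost κ (forestAt e i) (parentAt Δ e tie i) (childAt Δ e tie i)) := by
  induction t with
  | zero =>
    rw [run, expect_pure]
    simp
  | succ t ih =>
    have hu := expect_coloringLaw_eq (tie := tie) he hκ (t := t) (by omega)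
    have hp := (degree_parentAt_lt (tie := tie) he ht).trans_le hκ
    have hr := (degree_childAt_lt (tie := tie) he ht).trans_le hκ
    rw [expect_run_succ, Finset.sum_range_succ, ← ih (by omega)]
    simp only [Nat.cast_add, expect_add, expect_const]
    congr 1
    rw [← expect_coloringLaw (F := fun C => expect (insertBelow C (parentAt Δ e tie t)
      (childAt Δ e tie t)) fun C' => (recourse C C' : ℝ≥0∞)), hu.2,
      Finset.sum_congr rfl fun C hC => expect_recourse
        (isAcyclic_forestAt he (by omega)) (mem_properColorings.1 hC)
        (not_reachable_parentAt_childAt he ht) hp hr,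
      ← Finset.mul_sum, ← Finset.mul_sum, ← Nat.cast_sum, insertionCost,
      ENNReal.ofReal_div_of_pos, ENNReal.ofReal_mul (by positivity),
      ENNReal.ofReal_mul (by positivity)]
    · simp only [ENNReal.ofReal_natCast]
      rw [ENNReal.div_eq_inv_mul, ENNReal.mul_inv, ENNReal.mul_inv, mul_assoc, mul_assoc]
      · exact Or.inr (ENNReal.natCast_ne_top _)
      · exact Or.inl (ENNReal.natCast_ne_top _)
      · exact Or.inr (ENNReal.natCast_ne_top _)
      · exact Or.inl (ENNReal.mul_ne_top (ENNReal.natCast_ne_top _) (ENNReal.natCast_ne_top _))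
    · have h1 := Nat.pos_of_ne_zero hu.1
      have h2 := Nat.sub_pos_of_lt hp
      have h3 := Nat.sub_pos_of_lt hr
      positivity

open Classical in
/-- The number of pairs of a proper coloring and a choice `(β, α)` of the insertion for which the
child edge `rw` has the conflicting color `β`: the colors of the two trees are independent, and
the color of `rw` is uniformly distributed. -/
lemma card_mul_sum_card_conflict (h : ¬ G.Reachable p r) (hrw : G.Adj r w) :
    κ * ∑ β : Fin κ, ∑ α : Fin κ, ((properColorings κ G).filter fun C =>
      (β ∈ available C p ∧ C s(r, w) = some β) ∧ α ∈ available C r).card =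
    (properColorings κ G).card * (κ - (G.neighborSet p).ncard) * (κ - (G.neighborSet r).ncard) := by
  have h1 : ∀ β : Fin κ, ∑ α : Fin κ, ((properColorings κ G).filter fun C =>
      (β ∈ available C p ∧ C s(r, w) = some β) ∧ α ∈ available C r).card =
      ((properColorings κ G).filter fun C => β ∈ available C p ∧ C s(r, w) = some β).card *
        (κ - (G.neighborSet r).ncard) := by
    intro β
    simp only [← Finset.filter_filter (fun C => β ∈ available C p ∧ C s(r, w) = some β)]
    simp only [Finset.card_filter (fun C => _ ∈ available C r)]
    rw [Finset.sum_comm, ← smul_eq_mul, ← Finset.sum_const]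
    refine Finset.sum_congr rfl fun C hC => ?_
    rw [← card_available (mem_properColorings.1 (Finset.mem_filter.1 hC).1) r,
      ← Finset.card_filter]
    congr 1
    ext
    simp
  have h2 : ∀ β : Fin κ, κ * ((properColorings κ G).filter fun C =>
      β ∈ available C p ∧ C s(r, w) = some β).card =
      ((properColorings κ G).filter fun C => β ∈ available C p).card := by
    intro β
    have := card_mul_card_filter_color (S := {x | G.Reachable r x}) (f := s(r, w)) (b := β)
      (Ω := (properColorings κ G).filter fun C => β ∈ available C p) (Γ := Finset.univ)
      ?_ ?_ (Finset.mem_univ _) ?_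
    · rwa [Finset.card_univ, Fintype.card_fin, Finset.filter_filter] at this
    · intro C hC c _ d _
      obtain ⟨hC, hβ⟩ := Finset.mem_filter.1 hC
      rw [mem_properColorings] at hC
      refine Finset.mem_filter.2 ⟨mem_properColorings.2 (hC.swapOn ?_), ?_⟩
      · intro x hx y hy hxy
        exact absurd (SimpleGraph.Reachable.trans hx hxy.reachable) hy
      · rw [mem_available] at hβ ⊢
        intro y
        have hpS : p ∉ {x | G.Reachable r x} := fun hh => h (SimpleGraph.Reachable.symm hh)
        rw [swapOn_outside (not_inside_of_left hpS)]
        exact hβ y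
    · intro x hx
      rcases Sym2.mem_iff.1 hx with rfl | rfl
      · exact SimpleGraph.Reachable.refl _
      · exact hrw.reachable
    · intro C hC
      obtain ⟨c, hc⟩ := Option.ne_none_iff_exists'.1
        (((mem_properColorings.1 (Finset.mem_filter.1 hC).1).1 s(r, w)).2 ((SimpleGraph.mem_edgeSet _).2 hrw))
      exact ⟨c, Finset.mem_univ _, hc⟩
  rw [Finset.mul_sum]
  simp only [h1, ← mul_assoc, h2]
  rw [← Finset.sum_mul]
  congr 1
  simp only [Finset.card_filter]
  rw [Finset.sum_comm, ← smul_eq_mul, ← Finset.sum_const]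
  refine Finset.sum_congr rfl fun C hC => ?_
  rw [← card_available (mem_properColorings.1 hC) p, ← Finset.card_filter]
  congr 1
  ext
  simp

open Classical in
/-- The total recourse, split according to the first recolored edge. -/
lemma sum_sumChainLength_eq (h : ¬ G.Reachable p r) {F : Finset V} (hF : ∀ w, w ∈ F ↔ G.Adj r w) :
    ∑ C ∈ properColorings κ G, sumChainLength C p r =
      ∑ w ∈ F, ∑ β : Fin κ, ∑ α : Fin κ, ∑ C ∈ (properColorings κ G).filter (fun C =>
        (β ∈ available C p ∧ C s(r, w) = some β) ∧ α ∈ available C r),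
          (chainLength (Fintype.card V) C r w β α + 1) := by
  have hF' : ∀ w, w ∈ F ↔ w ≠ p ∧ G.Adj r w := by
    intro w
    rw [hF w]
    refine ⟨fun hh => ⟨?_, hh⟩, fun hh => hh.2⟩
    rintro rfl
    exact h hh.symm.reachable
  have h1 : ∀ C ∈ properColorings κ G, sumChainLength C p r =
      ∑ w ∈ F, ∑ β : Fin κ, ∑ α : Fin κ,
        if (β ∈ available C p ∧ C s(r, w) = some β) ∧ α ∈ available C r then
          chainLength (Fintype.card V) C r w β α + 1 else 0 := by
    intro C hC
    have huniv : ∀ (s : Finset (Fin κ)) (f : Fin κ → ℕ),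
        ∑ β ∈ s, f β = ∑ β, if β ∈ s then f β else 0 := by
      intro s f
      rw [← Finset.sum_filter]
      congr 1
      ext
      simp
    rw [sumChainLength, huniv, Finset.sum_comm]
    refine Finset.sum_congr rfl fun β _ => ?_
    rw [huniv, Finset.sum_comm]
    split_ifs with hβ
    · refine Finset.sum_congr rfl fun α _ => ?_
      split_ifs with hα
      · rw [chainLength_succ_eq_sum (mem_properColorings.1 hC) _ hF']
        simp [hβ, hα]
      · simp [hα]
    · simp [hβ]
  rw [Finset.sum_congr rfl h1, Finset.sum_comm]
  refine Finset.sum_congr rfl fun w _ => ?_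
  rw [Finset.sum_comm]
  refine Finset.sum_congr rfl fun β _ => ?_
  rw [Finset.sum_comm]
  refine Finset.sum_congr rfl fun α _ => ?_
  rw [Finset.sum_filter]

/-- The expected recourse is at most the sum over the child edges of the probability `1 / κ` of a
conflict, times a bound for the expected length of the path that starts with this edge. -/
lemma insertionCost_le (hG : G.IsAcyclic) (h : ¬ G.Reachable p r)
    (hp : (G.neighborSet p).ncard < κ) (hr : (G.neighborSet r).ncard < κ)
    (hN : (properColorings κ G).card ≠ 0) {F : Finset V} (hF : ∀ w, w ∈ F ↔ G.Adj r w) :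
    insertionCost κ G p r ≤
      (∑ w ∈ F, (1 + chainWeight κ G (Fintype.card V) r w)) / κ := by
  classical
  have hκ : 0 < κ := by omega
  have h1 := Nat.pos_of_ne_zero hN
  have h2 := Nat.sub_pos_of_lt hp
  have h3 := Nat.sub_pos_of_lt hr
  rw [insertionCost, div_le_div_iff₀ (by positivity) (by positivity),
    sum_sumChainLength_eq h hF]
  push_cast [Finset.sum_mul]
  refine Finset.sum_le_sum fun w hw => ?_
  have hrw := (hF w).1 hw
  have hcount := card_mul_sum_card_conflict (κ := κ) h hrw
  have hcount' : (κ : ℝ) * ∑ β : Fin κ, ∑ α : Fin κ, (((properColorings κ G).filter fun C =>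
      (β ∈ available C p ∧ C s(r, w) = some β) ∧ α ∈ available C r).card : ℝ) =
    (properColorings κ G).card * ((κ - (G.neighborSet p).ncard : ℕ) : ℝ) *
      ((κ - (G.neighborSet r).ncard : ℕ) : ℝ) := by exact_mod_cast hcount
  rw [← hcount', mul_comm (κ : ℝ), ← mul_assoc]
  simp only [← Finset.sum_mul]
  gcongr
  rw [Finset.mul_sum]
  refine Finset.sum_le_sum fun β _ => ?_
  rw [Finset.mul_sum]
  refine Finset.sum_le_sum fun α _ => ?_
  set Ω := (properColorings κ G).filter fun C =>
      (β ∈ available C p ∧ C s(r, w) = some β) ∧ α ∈ available C r with hΩ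
  have hmem : ∀ C ∈ Ω, IsProperEdgeColoring G C ∧
      (β ∈ available C p ∧ C s(r, w) = some β) ∧ α ∈ available C r := by
    intro C hC
    obtain ⟨h1, h2⟩ := Finset.mem_filter.1 hC
    exact ⟨mem_properColorings.1 h1, h2⟩
  by_cases hβα : β = α
  · have : Ω = ∅ := by
      refine Finset.eq_empty_of_forall_notMem fun C hC => ?_
      obtain ⟨-, ⟨-, h4⟩, h5⟩ := hmem C hC
      exact mem_available.1 h5 w (hβα ▸ h4)
    rw [this]
    simp
  · have hr' := parent_notMem_side hG hrw
    have hp' : p ∉ side G r w := fun hh => h ((hrw.reachable.trans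
      (SimpleGraph.Reachable.mono (SimpleGraph.deleteEdges_le _) hh)).symm)
    have := sum_chainLength_le hG (Fintype.card V) hrw hβα Ω (fun C hC => (hmem C hC).1)
      (fun C hC => (hmem C hC).2.1.2) ?_
    · rw [Finset.sum_add_distrib, Finset.sum_const, nsmul_eq_mul, mul_one]
      linarith
    · intro C hC C' hC' heq
      obtain ⟨h4, ⟨h5, h6⟩, h7⟩ := hmem C hC
      refine Finset.mem_filter.2 ⟨mem_properColorings.2 hC', ⟨?_, ?_⟩, ?_⟩
      · rw [mem_available] at h5 ⊢
        intro y
        rw [heq _ (not_inside_of_left hp')]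
        exact h5 y
      · rw [heq _ (not_inside_of_left hr'), h6]
      · rw [mem_available] at h7 ⊢
        intro y
        rw [heq _ (not_inside_of_left hr')]
        exact h7 y

/-- A conflict occurs with probability `deg r / κ`, and then at least one edge is recolored. -/
lemma le_insertionCost (h : ¬ G.Reachable p r)
    (hp : (G.neighborSet p).ncard < κ) (hr : (G.neighborSet r).ncard < κ)
    (hN : (properColorings κ G).card ≠ 0) :
    ((G.neighborSet r).ncard : ℝ) / κ ≤ insertionCost κ G p r := by
  classical
  have hκ : 0 < κ := by omega
  have h1 := Nat.pos_of_ne_zero hN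
  have h2 := Nat.sub_pos_of_lt hp
  have h3 := Nat.sub_pos_of_lt hr
  set F : Finset V := Finset.univ.filter fun w => G.Adj r w with hFdef
  have hF : ∀ w, w ∈ F ↔ G.Adj r w := by simp [hFdef]
  have hcard : (G.neighborSet r).ncard = F.card := by
    rw [← Set.ncard_coe_finset]
    congr 1
    ext w
    simp [hF]
  rw [insertionCost, div_le_div_iff₀ (by positivity) (by positivity)]
  have hle : ∀ w ∈ F, (properColorings κ G).card * (κ - (G.neighborSet p).ncard) *
      (κ - (G.neighborSet r).ncard) ≤
      κ * ∑ β : Fin κ, ∑ α : Fin κ, ∑ C ∈ (properColorings κ G).filter (fun C =>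
        (β ∈ available C p ∧ C s(r, w) = some β) ∧ α ∈ available C r),
          (chainLength (Fintype.card V) C r w β α + 1) := by
    intro w hw
    rw [← card_mul_sum_card_conflict h ((hF w).1 hw)]
    gcongr
    rw [Finset.card_eq_sum_ones]
    gcongr
    omega
  have hsum := Finset.sum_le_sum hle
  rw [Finset.sum_const, smul_eq_mul, ← Finset.mul_sum, ← sum_sumChainLength_eq h hF,
    mul_comm κ, ← hcard] at hsum
  exact_mod_cast hsum

end Cost

/-! ### Components under the insertion of an edge -/

/-- The vertex set of the component of `v`. -/
def component (G : SimpleGraph V) (v : V) : Set V := {x | G.Reachable v x}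

section Component

variable {G : SimpleGraph V} {p r x y : V}

lemma mem_component : y ∈ component G x ↔ G.Reachable x y := Iff.rfl

lemma self_mem_component : x ∈ component G x := SimpleGraph.Reachable.refl x

lemma component_eq (h : y ∈ component G x) : component G y = component G x := by
  ext z
  exact ⟨fun hz => SimpleGraph.Reachable.trans h hz,
    fun hz => SimpleGraph.Reachable.trans (SimpleGraph.Reachable.symm h) hz⟩

lemma disjoint_component (h : ¬ G.Reachable p r) : Disjoint (component G p) (component G r) := by
  rw [Set.disjoint_left]
  intro x hx hx'
  exact h (SimpleGraph.Reachable.trans hx (SimpleGraph.Reachable.symm hx'))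

lemma reachable_addEdge (hne : p ≠ r) : (addEdge G p r).Reachable x y ↔
    G.Reachable x y ∨ (G.Reachable x p ∧ G.Reachable r y) ∨
      (G.Reachable x r ∧ G.Reachable p y) := by
  have hpr : (addEdge G p r).Reachable p r :=
    ((addEdge_adj (G := G) hne).2 (Or.inr rfl)).reachable
  have hmono : ∀ {a b}, G.Reachable a b → (addEdge G p r).Reachable a b :=
    fun h => h.mono le_sup_left
  constructor
  · intro h
    rw [SimpleGraph.reachable_iff_reflTransGen] at h
    induction h with
    | refl => exact Or.inl (SimpleGraph.Reachable.refl _)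
    | tail _ hbc ih =>
      rcases (addEdge_adj hne).1 hbc with h | h
      · have := h.reachable
        rcases ih with ih | ⟨h1, h2⟩ | ⟨h1, h2⟩
        · exact Or.inl (ih.trans this)
        · exact Or.inr (Or.inl ⟨h1, h2.trans this⟩)
        · exact Or.inr (Or.inr ⟨h1, h2.trans this⟩)
      · rcases Sym2.eq_iff.1 h with ⟨rfl, rfl⟩ | ⟨rfl, rfl⟩
        · rcases ih with ih | ⟨h1, h2⟩ | ⟨h1, h2⟩
          · exact Or.inr (Or.inl ⟨ih, SimpleGraph.Reachable.refl _⟩)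
          · exact Or.inr (Or.inl ⟨h1, SimpleGraph.Reachable.refl _⟩)
          · exact Or.inl h1
        · rcases ih with ih | ⟨h1, h2⟩ | ⟨h1, h2⟩
          · exact Or.inr (Or.inr ⟨ih, SimpleGraph.Reachable.refl _⟩)
          · exact Or.inl h1
          · exact Or.inr (Or.inr ⟨h1, SimpleGraph.Reachable.refl _⟩)
  · rintro (h | ⟨h1, h2⟩ | ⟨h1, h2⟩)
    · exact hmono h
    · exact (hmono h1).trans (hpr.trans (hmono h2))
    · exact (hmono h1).trans (hpr.symm.trans (hmono h2))

lemma component_addEdge_self (hne : p ≠ r) :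
    component (addEdge G p r) p = component G p ∪ component G r := by
  ext y
  rw [mem_component, reachable_addEdge hne, Set.mem_union, mem_component, mem_component]
  have := SimpleGraph.Reachable.refl (G := G) p
  tauto

lemma component_addEdge_of_mem (hne : p ≠ r) (hx : x ∈ component G p ∪ component G r) :
    component (addEdge G p r) x = component G p ∪ component G r := by
  rw [← component_addEdge_self hne] at hx ⊢
  exact component_eq hx

lemma component_addEdge_of_notMem (hne : p ≠ r) (hx : x ∉ component G p ∪ component G r) :
    component (addEdge G p r) x = component G x := by
  ext y
  simp only [Set.mem_union, mem_component, not_or] at hx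
  rw [mem_component, mem_component, reachable_addEdge hne, SimpleGraph.reachable_comm (u := x)
    (v := p), SimpleGraph.reachable_comm (u := x) (v := r)]
  tauto

lemma inside_component_or {f : Sym2 V} (hf : f ∈ G.edgeSet)
    (h : ∀ w ∈ f, w ∈ component G p ∪ component G r) :
    (∀ w ∈ f, w ∈ component G p) ∨ (∀ w ∈ f, w ∈ component G r) := by
  induction f using Sym2.ind with
  | _ x y =>
    have hxy : G.Reachable x y := ((SimpleGraph.mem_edgeSet _).1 hf).reachable
    have key : ∀ {v}, G.Reachable v x → ∀ w ∈ s(x, y), w ∈ component G v := by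
      intro v hv w hw
      rcases Sym2.mem_iff.1 hw with rfl | rfl
      · exact hv
      · exact hv.trans hxy
    rcases h x (Sym2.mem_mk_left _ _) with hx | hx
    · exact Or.inl (key hx)
    · exact Or.inr (key hx)

lemma neighborSet_addEdge_of_ne (hne : p ≠ r) (hp : y ≠ p) (hr : y ≠ r) :
    (addEdge G p r).neighborSet y = G.neighborSet y := by
  ext w
  simp only [SimpleGraph.mem_neighborSet]
  rw [addEdge_adj hne]
  simp [hp, hr]

lemma componentSize_addEdge_of_mem [Finite V] (h : ¬ G.Reachable p r)
    (hx : x ∈ component G p ∪ component G r) :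
    componentSize (addEdge G p r) x = componentSize G p + componentSize G r + 1 := by
  have hne := ne_of_not_reachable h
  have h1 : {f ∈ (addEdge G p r).edgeSet | ∀ w ∈ f, w ∈ component (addEdge G p r) x} =
      insert s(p, r) ({f ∈ G.edgeSet | ∀ w ∈ f, w ∈ component G p} ∪
        {f ∈ G.edgeSet | ∀ w ∈ f, w ∈ component G r}) := by
    rw [component_addEdge_of_mem hne hx]
    ext f
    simp only [Set.mem_ofPred_eq, Set.mem_insert_iff, Set.mem_union f]
    rw [mem_edgeSet_addEdge hne]
    constructor
    · rintro ⟨hf | hf, hw⟩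
      · rcases inside_component_or hf hw with h | h
        · exact Or.inr (Or.inl ⟨hf, h⟩)
        · exact Or.inr (Or.inr ⟨hf, h⟩)
      · exact Or.inl hf
    · rintro (rfl | ⟨hf, hw⟩ | ⟨hf, hw⟩)
      · refine ⟨Or.inr rfl, fun w hw => ?_⟩
        rcases Sym2.mem_iff.1 hw with rfl | rfl
        · exact Or.inl self_mem_component
        · exact Or.inr self_mem_component
      · exact ⟨Or.inl hf, fun w hw' => Or.inl (hw w hw')⟩
      · exact ⟨Or.inl hf, fun w hw' => Or.inr (hw w hw')⟩
  have h2 : s(p, r) ∉ {f ∈ G.edgeSet | ∀ w ∈ f, w ∈ component G p} ∪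
      {f ∈ G.edgeSet | ∀ w ∈ f, w ∈ component G r} := by
    rintro (hh | hh) <;> exact notMem_edgeSet_of_not_reachable h hh.1
  have h3 : Disjoint {f ∈ G.edgeSet | ∀ w ∈ f, w ∈ component G p}
      {f ∈ G.edgeSet | ∀ w ∈ f, w ∈ component G r} := by
    rw [Set.disjoint_left]
    intro f hf hf'
    induction f using Sym2.ind with
    | _ x y =>
      exact Set.disjoint_left.1 (disjoint_component h) (hf.2 x (Sym2.mem_mk_left _ _))
        (hf'.2 x (Sym2.mem_mk_left _ _))
  have h4 := congrArg Set.ncard h1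
  rw [Set.ncard_insert_of_notMem h2, Set.ncard_union_eq h3] at h4
  exact h4

lemma componentSize_addEdge_of_notMem (hne : p ≠ r) (hx : x ∉ component G p ∪ component G r) :
    componentSize (addEdge G p r) x = componentSize G x := by
  have h1 : {f ∈ (addEdge G p r).edgeSet | ∀ w ∈ f, w ∈ component (addEdge G p r) x} =
      {f ∈ G.edgeSet | ∀ w ∈ f, w ∈ component G x} := by
    rw [component_addEdge_of_notMem hne hx]
    ext f
    simp only [Set.mem_ofPred_eq]
    rw [mem_edgeSet_addEdge hne]
    refine and_congr_left fun hw => or_iff_left ?_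
    rintro rfl
    exact hx (Or.inl (SimpleGraph.Reachable.symm (hw p (Sym2.mem_mk_left _ _))))
  exact congrArg Set.ncard h1

lemma ncard_component_addEdge [Finite V] (h : ¬ G.Reachable p r)
    (hx : x ∈ component G p ∪ component G r) :
    (component (addEdge G p r) x).ncard = (component G p).ncard + (component G r).ncard := by
  rw [component_addEdge_of_mem (ne_of_not_reachable h) hx, Set.ncard_union_eq
    (disjoint_component h)]

variable {Δ : ℕ} {e : ℕ → V × V} {tie : ℕ → Bool} {m t : ℕ}

/-- A tree has one more vertex than it has edges. -/
lemma componentSize_add_one [Finite V] (he : IsInsertionSequence Δ e m) (ht : t ≤ m) (x : V) :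
    componentSize (forestAt e t) x + 1 = (component (forestAt e t) x).ncard := by
  induction t generalizing x with
  | zero =>
    have h1 : componentSize (forestAt e 0) x = 0 := by
      simp [componentSize, forestAt]
    have h2 : component (forestAt e 0) x = {x} := by
      ext y
      simp [mem_component, forestAt, eq_comm]
    rw [h1, h2, Set.ncard_singleton]
  | succ t ih =>
    have h := he.1 t ht
    have ih' := ih (by omega)
    change componentSize (addEdge (forestAt e t) (e t).1 (e t).2) x + 1 =
      (component (addEdge (forestAt e t) (e t).1 (e t).2) x).ncard
    by_cases hx : x ∈ component (forestAt e t) (e t).1 ∪ component (forestAt e t) (e t).2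
    · rw [componentSize_addEdge_of_mem h hx, ncard_component_addEdge h hx, ← ih' (e t).1,
        ← ih' (e t).2]
      omega
    · rw [componentSize_addEdge_of_notMem (ne_of_not_reachable h) hx,
        component_addEdge_of_notMem (ne_of_not_reachable h) hx, ih']

lemma mayReroot_parentAt_childAt :
    MayReroot Δ (forestAt e t) (parentAt Δ e tie t) (childAt Δ e tie t) := by
  have htotal : ∀ u v : V, ¬ MayReroot Δ (forestAt e t) u v → MayReroot Δ (forestAt e t) v u := by
    intro u v h
    unfold MayReroot at h ⊢
    by_cases hs : componentSize (forestAt e t) v ≤ Δ ∧ componentSize (forestAt e t) u ≤ Δ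
    · simp only [hs, and_self, forall_const, not_true_eq_false, false_imp_iff, and_true]
        at h ⊢
      omega
    · simp only [hs, false_imp_iff, not_false_eq_true, forall_const, true_and] at h ⊢
      omega
  unfold parentAt childAt orient
  split_ifs with h
  · exact h.1
  · by_cases h1 : MayReroot Δ (forestAt e t) (e t).1 (e t).2
    · by_contra h2
      exact h ⟨h1, Or.inl h2⟩
    · exact htotal _ _ h1

end Component

/-! ### The potential -/

/-- The function `min x √x`. -/
noncomputable def minSqrt (x : ℝ) : ℝ := min x √x

lemma minSqrt_nonneg {x : ℝ} (hx : 0 ≤ x) : 0 ≤ minSqrt x := le_min hx (Real.sqrt_nonneg x)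

lemma minSqrt_of_le_one {x : ℝ} (hx : 0 ≤ x) (h : x ≤ 1) : minSqrt x = x :=
  min_eq_left (Real.le_sqrt_of_sq_le (by nlinarith))

lemma minSqrt_of_one_le {x : ℝ} (h : 1 ≤ x) : minSqrt x = √x :=
  min_eq_right (Real.sqrt_le_left (by linarith) |>.2 (by nlinarith))

lemma minSqrt_add_le_of_one_le {x y : ℝ} (hx : 0 ≤ x) (hxy : x ≤ y) (hy : 1 ≤ y) :
    minSqrt (x + y) ≤ minSqrt y + minSqrt x / 2 := by
  have h1 : 1 ≤ √y := Real.one_le_sqrt.2 hy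
  have h2 : √y ^ 2 = y := Real.sq_sqrt (by linarith)
  have h3 := minSqrt_nonneg hx
  have h4 : x ≤ minSqrt x * √y := by
    rcases le_total x 1 with h | h
    · rw [minSqrt_of_le_one hx h]
      nlinarith
    · rw [minSqrt_of_one_le h]
      calc x = √x * √x := (Real.mul_self_sqrt hx).symm
        _ ≤ √x * √y := by gcongr
  rw [minSqrt_of_one_le hy]
  refine (min_le_right _ _).trans ?_
  rw [Real.sqrt_le_left (by positivity)]
  nlinarith

lemma minSqrt_add_le {x y : ℝ} (hx : 0 ≤ x) (hy : 0 ≤ y) :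
    minSqrt (x + y) ≤ minSqrt x + minSqrt y := by
  wlog hxy : x ≤ y generalizing x y
  · rw [add_comm x, add_comm (minSqrt x)]
    exact this hy hx (le_of_not_ge hxy)
  rcases le_total y 1 with h | h
  · rw [minSqrt_of_le_one hy h, minSqrt_of_le_one hx (hxy.trans h)]
    exact min_le_left _ _
  · linarith [minSqrt_add_le_of_one_le hx hxy h, minSqrt_nonneg hx]

section Potential

variable [Fintype V] {G : SimpleGraph V} {p r x y : V} {Δ : ℕ}

open Classical in
/-- The maximal degree in the component of `x`. -/
noncomputable def maxDegreeOn (G : SimpleGraph V) (x : V) : ℕ :=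
  (Finset.univ.filter fun y => y ∈ component G x).sup fun y => (G.neighborSet y).ncard

lemma degree_le_maxDegreeOn (h : y ∈ component G x) :
    (G.neighborSet y).ncard ≤ maxDegreeOn G x := by
  classical
  exact Finset.le_sup (f := fun y => (G.neighborSet y).ncard) (by simpa using h)

lemma maxDegreeOn_le {n : ℕ} (h : ∀ y ∈ component G x, (G.neighborSet y).ncard ≤ n) :
    maxDegreeOn G x ≤ n := by
  classical
  exact Finset.sup_le fun y hy => h y (by simpa using hy)

/-- The part of the potential that belongs to the tree of `x`, with `s` edges and maximal degree `M`:
it is `8 * min (s / Δ) √(s / Δ) + M / Δ`. The first summand pays for the insertions into large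
trees, the second one for the degrees in small trees. -/
noncomputable def treePotential (Δ : ℕ) (G : SimpleGraph V) (x : V) : ℝ :=
  8 * minSqrt ((((component G x).ncard : ℝ) - 1) / Δ) + (maxDegreeOn G x : ℝ) / Δ

/-- The sum of the tree potentials over all trees, written as a sum over the vertices. -/
noncomputable def potential (Δ : ℕ) (G : SimpleGraph V) : ℝ :=
  ∑ x, treePotential Δ G x / (component G x).ncard

lemma one_le_ncard_component : 1 ≤ (component G x).ncard :=
  Set.ncard_pos (Set.toFinite _) |>.2 ⟨x, self_mem_component⟩

lemma one_le_cast_ncard_component : (1 : ℝ) ≤ (component G x).ncard := by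
  exact_mod_cast one_le_ncard_component

lemma treePotential_nonneg : 0 ≤ treePotential Δ G x := by
  have h1 : (0 : ℝ) ≤ (component G x).ncard - 1 := by
    linarith [one_le_cast_ncard_component (G := G) (x := x)]
  have h2 := minSqrt_nonneg (div_nonneg h1 (Nat.cast_nonneg Δ))
  unfold treePotential
  positivity

lemma potential_nonneg : 0 ≤ potential Δ G :=
  Finset.sum_nonneg fun _ _ => div_nonneg treePotential_nonneg (Nat.cast_nonneg _)

lemma maxDegreeOn_congr (h : y ∈ component G x) : maxDegreeOn G y = maxDegreeOn G x := by
  rw [maxDegreeOn, maxDegreeOn, component_eq h]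

lemma treePotential_congr (h : y ∈ component G x) :
    treePotential Δ G y = treePotential Δ G x := by
  rw [treePotential, treePotential, component_eq h, maxDegreeOn_congr h]

open Classical in
/-- The vertices of one tree together contribute the potential of this tree. -/
lemma sum_component_treePotential (G : SimpleGraph V) (x : V) :
    ∑ y ∈ Finset.univ.filter (fun y => y ∈ component G x),
      treePotential Δ G y / (component G y).ncard = treePotential Δ G x := by
  have h1 : ∀ y ∈ Finset.univ.filter (fun y => y ∈ component G x),
      treePotential Δ G y / (component G y).ncard =
        treePotential Δ G x / (component G x).ncard := by
    intro y hy
    have hy' : y ∈ component G x := by simpa using hy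
    rw [treePotential_congr hy', component_eq hy']
  have h2 : (Finset.univ.filter fun y => y ∈ component G x).card = (component G x).ncard := by
    rw [← Set.ncard_coe_finset]
    congr 1
    ext y
    simp
  rw [Finset.sum_congr rfl h1, Finset.sum_const, h2, nsmul_eq_mul]
  have := one_le_cast_ncard_component (G := G) (x := x)
  field_simp

lemma degree_addEdge_le (h : ¬ G.Reachable p r) (y : V) :
    ((addEdge G p r).neighborSet y).ncard ≤ (G.neighborSet y).ncard + 1 := by
  by_cases hr : y = r
  · rw [hr, ncard_neighborSet_addEdge h]
  · by_cases hp : y = p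
    · rw [hp, addEdge, SimpleGraph.edge_comm, ncard_neighborSet_addEdge fun hh => h hh.symm]
    · rw [neighborSet_addEdge_of_ne (ne_of_not_reachable h) hp hr]
      omega

lemma maxDegreeOn_addEdge_le (h : ¬ G.Reachable p r) :
    maxDegreeOn (addEdge G p r) p ≤ max (maxDegreeOn G p) (maxDegreeOn G r) + 1 := by
  refine maxDegreeOn_le fun y hy => (degree_addEdge_le h y).trans ?_
  rw [component_addEdge_self (ne_of_not_reachable h)] at hy
  rcases hy with hy | hy
  · have := degree_le_maxDegreeOn hy
    omega
  · have := degree_le_maxDegreeOn hy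
    omega

lemma treePotential_addEdge_of_notMem (hne : p ≠ r)
    (hx : x ∉ component G p ∪ component G r) :
    treePotential Δ (addEdge G p r) x = treePotential Δ G x := by
  have h1 := component_addEdge_of_notMem hne hx
  have h2 : maxDegreeOn (addEdge G p r) x = maxDegreeOn G x := by
    rw [maxDegreeOn, maxDegreeOn, h1]
    refine Finset.sup_congr rfl fun y hy => ?_
    have hy' : G.Reachable x y := by simpa [mem_component] using hy
    rw [neighborSet_addEdge_of_ne hne]
    · rintro rfl
      exact hx (Or.inl hy'.symm)
    · rintro rfl
      exact hx (Or.inr hy'.symm)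
  rw [treePotential, treePotential, h1, h2]

/-- An insertion replaces the potentials of the two trees by the potential of their union. -/
lemma potential_addEdge (h : ¬ G.Reachable p r) :
    potential Δ (addEdge G p r) = potential Δ G - treePotential Δ G p - treePotential Δ G r +
      treePotential Δ (addEdge G p r) p := by
  classical
  have hne := ne_of_not_reachable h
  have h1 := sum_component_treePotential (Δ := Δ) (addEdge G p r) p
  have h2 := sum_component_treePotential (Δ := Δ) G p
  have h3 := sum_component_treePotential (Δ := Δ) G r
  rw [potential, potential, ← h1, ← h2, ← h3,
    ← Finset.sum_filter_add_sum_filter_not Finset.univ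
      (fun y => y ∈ component (addEdge G p r) p),
    ← Finset.sum_filter_add_sum_filter_not (s := Finset.univ) (f := fun y =>
      treePotential Δ G y / (component G y).ncard) (fun y => y ∈ component (addEdge G p r) p)]
  have hJ := component_addEdge_self (G := G) hne
  have h4 : (Finset.univ.filter fun y => y ∈ component (addEdge G p r) p) =
      (Finset.univ.filter fun y => y ∈ component G p) ∪
        Finset.univ.filter fun y => y ∈ component G r := by
    ext y
    simp [hJ]
  have h5 : Disjoint (Finset.univ.filter fun y => y ∈ component G p)
      (Finset.univ.filter fun y => y ∈ component G r) := by
    rw [Finset.disjoint_filter]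
    intro y _ hy hy'
    exact Set.disjoint_left.1 (disjoint_component h) hy hy'
  rw [h4, Finset.sum_union h5 (f := fun y => treePotential Δ G y / (component G y).ncard)]
  have h6 : ∑ y ∈ Finset.univ.filter (fun y => y ∉ component (addEdge G p r) p),
      treePotential Δ (addEdge G p r) y / (component (addEdge G p r) y).ncard =
      ∑ y ∈ Finset.univ.filter (fun y => y ∉ component (addEdge G p r) p),
      treePotential Δ G y / (component G y).ncard := by
    refine Finset.sum_congr rfl fun y hy => ?_
    have hy' : y ∉ component G p ∪ component G r :=
      hJ ▸ (Finset.mem_filter.1 hy).2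
    rw [treePotential_addEdge_of_notMem hne hy', component_addEdge_of_notMem hne hy']
  rw [h6]
  ring

/-- Bounds for the expected recourse of one insertion, in terms of the number `s` of edges of the
tree of `r`. -/
lemma insertionCost_bounds (hG : G.IsAcyclic) (h : ¬ G.Reachable p r) (hκ : 3 ≤ κ)
    (hdeg : ∀ v, (G.neighborSet v).ncard ≤ κ)
    (hp : (G.neighborSet p).ncard < κ) (hr : (G.neighborSet r).ncard < κ)
    (hN : (properColorings κ G).card ≠ 0) {s : ℝ} (hs : s = ((component G r).ncard : ℝ) - 1) :
    insertionCost κ G p r ≤ s / κ ∧ insertionCost κ G p r ≤ 4 * √(s / κ) ∧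
      insertionCost κ G p r ≤ ((G.neighborSet r).ncard + s / ((κ : ℝ) - 1)) / κ := by
  classical
  have hκ' : (3 : ℝ) ≤ κ := by exact_mod_cast hκ
  set F : Finset V := Finset.univ.filter fun w => G.Adj r w with hFdef
  have hF : ∀ w, w ∈ F ↔ G.Adj r w := by simp [hFdef]
  have hcard : F.card = (G.neighborSet r).ncard := by
    rw [← Set.ncard_coe_finset]
    congr 1
    ext w
    simp [hF]
  have hone : ∀ w : V, (1 : ℝ) ≤ ((side G r w).ncard : ℝ) := fun w => by
    exact_mod_cast one_le_ncard_side
  have hsize : ∑ w ∈ F, ((side G r w).ncard : ℝ) ≤ s := by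
    have := sum_ncard_side_add_one_le hG (fun w hw => (hF w).1 hw) (S := component G r)
      self_mem_component fun w hw x hx => ((hF w).1 hw).reachable.trans
        (SimpleGraph.Reachable.mono (SimpleGraph.deleteEdges_le _) hx)
    have h1 : ∑ w ∈ F, ((side G r w).ncard : ℝ) + 1 ≤ (component G r).ncard := by
      exact_mod_cast this
    linarith
  have hs0 : 0 ≤ s := by
    have := one_le_cast_ncard_component (G := G) (x := r)
    linarith
  have hcost := insertionCost_le hG h hp hr hN hF
  have hlin : ∀ w ∈ F, chainWeight κ G (Fintype.card V) r w ≤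
      (((side G r w).ncard : ℝ) - 1) / ((κ : ℝ) - 1) := fun w _ =>
    chainWeight_le_linear hG (by omega) _
  refine ⟨hcost.trans ?_, hcost.trans ?_, hcost.trans ?_⟩
  · gcongr
    refine (Finset.sum_le_sum fun w hw => ?_).trans hsize
    have := (hlin w hw).trans (div_le_self (by linarith [hone w]) (by linarith))
    linarith
  · have h1 := sum_one_add_sqrt_le F (fun w => ((side G r w).ncard : ℝ)) (fun w _ => hone w)
      hsize (q := κ) (by rw [hcard]; exact_mod_cast hdeg r)
    rw [div_le_iff₀ (by linarith)]
    calc ∑ w ∈ F, (1 + chainWeight κ G (Fintype.card V) r w)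
        ≤ ∑ w ∈ F, (1 + 4 * √((((side G r w).ncard : ℝ) - 1) / 2)) := by
          refine Finset.sum_le_sum fun w hw => ?_
          have h2 := chainWeight_le_sqrt hG hκ hdeg (Fintype.card V) ((hF w).1 hw)
          have h3 : √((((side G r w).ncard : ℝ) - 1) / ((κ : ℝ) - 1)) ≤
              √((((side G r w).ncard : ℝ) - 1) / 2) := by
            apply Real.sqrt_le_sqrt
            have := hone w
            gcongr
            linarith
          linarith
      _ ≤ 4 * √(κ * s) := h1
      _ = 4 * √(s / κ) * κ := by
          have h5 : κ * s = s / κ * (κ : ℝ) ^ 2 := by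
            field_simp
          rw [h5, Real.sqrt_mul' _ (sq_nonneg _), Real.sqrt_sq (by linarith), mul_assoc]
  · gcongr
    rw [Finset.sum_add_distrib, Finset.sum_const, nsmul_eq_mul, mul_one, hcard]
    gcongr
    calc ∑ w ∈ F, chainWeight κ G (Fintype.card V) r w
        ≤ ∑ w ∈ F, ((side G r w).ncard : ℝ) / ((κ : ℝ) - 1) := by
          refine Finset.sum_le_sum fun w hw => (hlin w hw).trans ?_
          gcongr
          · linarith
          · linarith
      _ ≤ s / ((κ : ℝ) - 1) := by
          rw [← Finset.sum_div]
          gcongr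
          linarith

/-- The expected recourse of an insertion is at most `11 / Δ`, plus the loss of potential. -/
lemma insertionCost_le_potential (hG : G.IsAcyclic) (h : ¬ G.Reachable p r) (hΔ : 3 ≤ Δ)
    (hκ : Δ ≤ κ) (hdeg : ∀ v, (G.neighborSet v).ncard ≤ Δ)
    (hp : (G.neighborSet p).ncard < Δ) (hr : (G.neighborSet r).ncard < Δ)
    (hN : (properColorings κ G).card ≠ 0)
    (hsize : ∀ x, componentSize G x + 1 = (component G x).ncard) (hroot : MayReroot Δ G p r) :
    insertionCost κ G p r ≤ 11 / Δ + potential Δ G - potential Δ (addEdge G p r) := by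
  have hΔ' : (3 : ℝ) ≤ Δ := by exact_mod_cast hΔ
  have hκ' : (Δ : ℝ) ≤ κ := by exact_mod_cast hκ
  have hΔ0 : (0 : ℝ) < Δ := by linarith
  have hsz : ∀ x, ((component G x).ncard : ℝ) - 1 = componentSize G x := by
    intro x
    rw [← hsize x]
    push_cast
    ring
  obtain ⟨hc1, hc2, hc3⟩ := insertionCost_bounds (κ := κ) hG h (by omega)
    (fun v => (hdeg v).trans hκ) (by omega) (by omega) hN rfl
  rw [hsz] at hc1 hc2 hc3
  set s := (componentSize G r : ℝ) with hs
  set s' := (componentSize G p : ℝ) with hs'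
  have hs0 : 0 ≤ s := Nat.cast_nonneg _
  have hs0' : 0 ≤ s' := Nat.cast_nonneg _
  set c := insertionCost κ G p r with hc
  have hn : ((component (addEdge G p r) p).ncard : ℝ) - 1 = s + s' + 1 := by
    have h1 := hsz p
    have h2 := hsz r
    rw [ncard_component_addEdge h (Or.inl self_mem_component)]
    push_cast
    linarith
  have hM := maxDegreeOn_addEdge_le h
  have hMp := degree_le_maxDegreeOn (self_mem_component (G := G) (x := p))
  have hMr := degree_le_maxDegreeOn (self_mem_component (G := G) (x := r))
  rw [potential_addEdge h, treePotential, treePotential, treePotential, hn, hsz, hsz, ← hs, ← hs']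
  have hsplit : (s + s' + 1) / (Δ : ℝ) = 1 / Δ + (s / Δ + s' / Δ) := by ring
  have hinv : (1 : ℝ) / Δ ≤ 1 := by
    rw [div_le_one hΔ0]
    linarith
  have hx0 : 0 ≤ s / (Δ : ℝ) := by positivity
  have hx0' : 0 ≤ s' / (Δ : ℝ) := by positivity
  have hmu1 : minSqrt ((s + s' + 1) / Δ) ≤ 1 / Δ + minSqrt (s / Δ + s' / Δ) := by
    rw [hsplit]
    refine (minSqrt_add_le (by positivity) (by positivity)).trans ?_
    rw [minSqrt_of_le_one (by positivity) hinv]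
  by_cases hsmall : componentSize G r ≤ Δ ∧ componentSize G p ≤ Δ
  · have hd := hroot.1 hsmall
    have hmu2 := minSqrt_add_le hx0 hx0'
    have hM' : (maxDegreeOn (addEdge G p r) p : ℝ) + (G.neighborSet r).ncard ≤
        maxDegreeOn G p + maxDegreeOn G r + 1 := by
      have : maxDegreeOn (addEdge G p r) p + (G.neighborSet r).ncard ≤
          maxDegreeOn G p + maxDegreeOn G r + 1 := by
        rcases le_total (maxDegreeOn G p) (maxDegreeOn G r) with h' | h'
        · rw [max_eq_right h'] at hM
          omega
        · rw [max_eq_left h'] at hM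
          omega
      exact_mod_cast this
    have hsΔ : s ≤ Δ := by
      rw [hs]
      exact_mod_cast hsmall.1
    -- since `Δ ≤ 2 * (κ - 1)`, the edges that are not incident to `r` contribute at most `2 / Δ`
    have hc4 : c ≤ ((G.neighborSet r).ncard + 2) / Δ := by
      refine hc3.trans ?_
      gcongr
      rw [div_le_iff₀ (by linarith)]
      linarith
    have hM'' : ((maxDegreeOn (addEdge G p r) p : ℝ) + (G.neighborSet r).ncard) / Δ ≤
        (maxDegreeOn G p + maxDegreeOn G r + 1) / Δ := by gcongr
    have e1 : ((maxDegreeOn (addEdge G p r) p : ℝ) + (G.neighborSet r).ncard) / Δ =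
        (maxDegreeOn (addEdge G p r) p : ℝ) / Δ + (G.neighborSet r).ncard / Δ := by ring
    have e2 : ((maxDegreeOn G p : ℝ) + maxDegreeOn G r + 1) / Δ =
        (maxDegreeOn G p : ℝ) / Δ + maxDegreeOn G r / Δ + 1 / Δ := by ring
    have e3 : (((G.neighborSet r).ncard : ℝ) + 2) / Δ =
        (G.neighborSet r).ncard / Δ + 2 * (1 / Δ) := by ring
    have e4 : (11 : ℝ) / Δ = 11 * (1 / Δ) := by ring
    rw [e1, e2] at hM''
    rw [e3] at hc4
    rw [e4]
    linarith
  · have hle := hroot.2 hsmall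
    have hle' : s / (Δ : ℝ) ≤ s' / Δ := by
      gcongr
      rw [hs, hs']
      exact_mod_cast hle
    have hbig : 1 ≤ s' / (Δ : ℝ) := by
      rw [one_le_div hΔ0, hs']
      have : Δ ≤ componentSize G p := by omega
      exact_mod_cast this
    have hmu2 := minSqrt_add_le_of_one_le hx0 hle' hbig
    have hM' : (maxDegreeOn (addEdge G p r) p : ℝ) ≤ maxDegreeOn G p + maxDegreeOn G r + 1 := by
      have : maxDegreeOn (addEdge G p r) p ≤ maxDegreeOn G p + maxDegreeOn G r + 1 := by omega
      exact_mod_cast this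
    have hsκ : s / (κ : ℝ) ≤ s / Δ := by gcongr
    have hc4 : c ≤ 4 * minSqrt (s / Δ) := by
      rw [minSqrt, mul_min_of_nonneg _ _ (by norm_num)]
      refine le_min ?_ (hc2.trans ?_)
      · linarith
      · gcongr
    have hM'' : (maxDegreeOn (addEdge G p r) p : ℝ) / Δ ≤
        (maxDegreeOn G p + maxDegreeOn G r + 1) / Δ := by gcongr
    have e2 : ((maxDegreeOn G p : ℝ) + maxDegreeOn G r + 1) / Δ =
        (maxDegreeOn G p : ℝ) / Δ + maxDegreeOn G r / Δ + 1 / Δ := by ring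
    have e4 : (11 : ℝ) / Δ = 11 * (1 / Δ) := by ring
    have hpos : 0 < (1 : ℝ) / Δ := by positivity
    rw [e2] at hM''
    rw [e4]
    linarith

variable {e : ℕ → V × V} {tie : ℕ → Bool} {m : ℕ}

lemma potential_bot : potential Δ (⊥ : SimpleGraph V) = 0 := by
  refine Finset.sum_eq_zero fun x _ => ?_
  have h1 : component (⊥ : SimpleGraph V) x = {x} := by
    ext y
    simp [mem_component, eq_comm]
  have h2 : maxDegreeOn (⊥ : SimpleGraph V) x = 0 := by
    refine Nat.le_zero.1 (maxDegreeOn_le fun y _ => ?_)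
    simp
  simp [treePotential, h1, h2, minSqrt]

lemma sum_insertionCost_le (he : IsInsertionSequence Δ e m) (hΔ : 3 ≤ Δ) (hκ : Δ ≤ κ) :
    ∑ i ∈ Finset.range m,
      insertionCost κ (forestAt e i) (parentAt Δ e tie i) (childAt Δ e tie i) ≤ m * (11 / Δ) := by
  have key : ∀ t ≤ m, ∑ i ∈ Finset.range t,
      insertionCost κ (forestAt e i) (parentAt Δ e tie i) (childAt Δ e tie i) ≤
        t * (11 / Δ) - potential Δ (forestAt e t) := by
    intro t
    induction t with
    | zero => simp [forestAt, potential_bot]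
    | succ t ih =>
      intro ht
      have h1 := ih (by omega)
      have h2 := insertionCost_le_potential (κ := κ) (isAcyclic_forestAt he (t := t) (by omega))
        (not_reachable_parentAt_childAt (tie := tie) he ht) hΔ hκ (he.2 t (by omega))
        (degree_parentAt_lt he ht) (degree_childAt_lt he ht)
        (expect_coloringLaw_eq (tie := tie) he hκ (by omega)).1
        (componentSize_add_one he (by omega)) mayReroot_parentAt_childAt
      rw [← forestAt_succ_eq] at h2
      rw [Finset.sum_range_succ]
      push_cast
      linarith
  linarith [key m le_rfl, potential_nonneg (Δ := Δ) (G := forestAt e m)]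

lemma insertionCost_nonneg (κ : ℕ) (G : SimpleGraph V) (p r : V) :
    0 ≤ insertionCost κ G p r := by
  unfold insertionCost
  positivity

lemma expectedAmortizedRecourse_eq (he : IsInsertionSequence Δ e m) (hκ : Δ ≤ κ) :
    expectedAmortizedRecourse Δ κ e tie m = ENNReal.ofReal (∑ i ∈ Finset.range m,
      insertionCost κ (forestAt e i) (parentAt Δ e tie i) (childAt Δ e tie i)) / m := by
  have h1 := expect_total_recourse (tie := tie) he hκ le_rfl
  rw [expect] at h1
  rw [expectedAmortizedRecourse, h1, ENNReal.ofReal_sum_of_nonneg]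
  intro i _
  exact insertionCost_nonneg _ _ _ _

lemma expectedAmortizedRecourse_le (he : IsInsertionSequence Δ e m) (hΔ : 3 ≤ Δ) (hκ : Δ ≤ κ) :
    expectedAmortizedRecourse Δ κ e tie m ≤ ENNReal.ofReal (11 / Δ) := by
  rw [expectedAmortizedRecourse_eq he hκ]
  refine ENNReal.div_le_of_le_mul ?_
  rw [← ENNReal.ofReal_natCast, ← ENNReal.ofReal_mul (by positivity), mul_comm]
  exact ENNReal.ofReal_le_ofReal (sum_insertionCost_le he hΔ hκ)

end Potential

/-! ### A sequence with large recourse -/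

section LowerBound

variable {m t i : ℕ} {x : ℕ → V}

/-- The order in which the edges of a path with `m` edges are inserted: the edges with an even
index first, and then the edges with an odd index, which connect the former ones. -/
def pathOrder (m t : ℕ) : ℕ := if t < (m + 1) / 2 then 2 * t else 2 * (t - (m + 1) / 2) + 1

lemma pathOrder_lt (ht : t < m) : pathOrder m t < m := by
  unfold pathOrder
  split_ifs <;> omega

lemma pathOrder_ne (hi : i < t) : pathOrder m i ≠ pathOrder m t := by
  unfold pathOrder
  split_ifs <;> omega

/-- The insertion sequence of the path `x 0, x 1, …, x m` in the order `pathOrder`. -/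
def pathSequence (m : ℕ) (x : ℕ → V) (t : ℕ) : V × V := (x (pathOrder m t), x (pathOrder m t + 1))

lemma forestAt_adj (e : ℕ → V × V) (t : ℕ) (a b : V) :
    (forestAt e t).Adj a b ↔ a ≠ b ∧ ∃ i < t, s(a, b) = s((e i).1, (e i).2) := by
  induction t with
  | zero => simp [forestAt]
  | succ t ih =>
    rw [forestAt, SimpleGraph.sup_adj, ih, SimpleGraph.edge_adj, Nat.exists_lt_succ_right,
      ← Sym2.eq_iff, and_comm (b := a ≠ b), ← and_or_left]

lemma pathSequence_adj {a b : V} (ht : t ≤ m) (h : (forestAt (pathSequence m x) t).Adj a b) :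
    ∃ i < t, pathOrder m i < m ∧
      (a = x (pathOrder m i) ∧ b = x (pathOrder m i + 1) ∨
        a = x (pathOrder m i + 1) ∧ b = x (pathOrder m i)) := by
  obtain ⟨-, i, hi, he⟩ := (forestAt_adj _ _ _ _).1 h
  exact ⟨i, hi, pathOrder_lt (by omega), Sym2.eq_iff.1 he⟩

/-- Any insertion order of the edges of a path is legal: before the edge with index `a` is inserted,
no edge leaves the set of the first `a + 1` vertices. -/
lemma isInsertionSequence_pathSequence [Finite V] {Δ : ℕ} (hΔ : 2 ≤ Δ)
    (hx : Set.InjOn x (Set.Iic m)) : IsInsertionSequence Δ (pathSequence m x) m := by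
  constructor
  · intro t ht hreach
    have ha := pathOrder_lt ht
    set a := pathOrder m t with hadef
    have key : ∀ y, (forestAt (pathSequence m x) t).Reachable (x a) y → ∃ j ≤ a, y = x j := by
      intro y hy
      rw [SimpleGraph.reachable_iff_reflTransGen] at hy
      induction hy with
      | refl => exact ⟨a, le_rfl, rfl⟩
      | tail _ hbc ih =>
        obtain ⟨j, hj, rfl⟩ := ih
        obtain ⟨i, hi, him, h⟩ := pathSequence_adj ht.le hbc
        have hne := pathOrder_ne (m := m) hi
        rcases h with ⟨h1, rfl⟩ | ⟨h1, rfl⟩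
        · have := hx (by simp only [Set.mem_Iic]; omega) (by simp only [Set.mem_Iic]; omega) h1
          exact ⟨_, by omega, rfl⟩
        · have := hx (by simp only [Set.mem_Iic]; omega) (by simp only [Set.mem_Iic]; omega) h1
          exact ⟨_, by omega, rfl⟩
    obtain ⟨j, hj, h⟩ := key _ hreach
    have h' : x (a + 1) = x j := h
    have := hx (by simp only [Set.mem_Iic]; omega) (by simp only [Set.mem_Iic]; omega) h'
    omega
  · intro t ht v
    by_cases hv : ∃ j ≤ m, v = x j
    · obtain ⟨j, hj, rfl⟩ := hv
      have hsub : (forestAt (pathSequence m x) t).neighborSet (x j) ⊆ {x (j - 1), x (j + 1)} := by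
        intro b hb
        obtain ⟨i, hi, him, h⟩ := pathSequence_adj ht ((SimpleGraph.mem_neighborSet _ _ _).1 hb)
        rcases h with ⟨h1, rfl⟩ | ⟨h1, rfl⟩
        · have := hx (by simp only [Set.mem_Iic]; omega) (by simp only [Set.mem_Iic]; omega) h1
          right
          rw [this]
          rfl
        · have := hx (by simp only [Set.mem_Iic]; omega) (by simp only [Set.mem_Iic]; omega) h1
          left
          rw [this]
          rfl
      have h2 := Set.ncard_insert_le (x (j - 1)) {x (j + 1)}
      rw [Set.ncard_singleton] at h2
      exact (Set.ncard_le_ncard hsub (Set.toFinite _)).trans (h2.trans hΔ)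
    · have hempty : (forestAt (pathSequence m x) t).neighborSet v = ∅ := by
        refine Set.eq_empty_of_forall_notMem fun b hb => hv ?_
        obtain ⟨i, hi, him, h⟩ := pathSequence_adj ht ((SimpleGraph.mem_neighborSet _ _ _).1 hb)
        rcases h with ⟨h1, _⟩ | ⟨h1, _⟩
        · exact ⟨_, by omega, h1⟩
        · exact ⟨_, by omega, h1⟩
      rw [hempty, Set.ncard_empty]
      omega

/-- When an inner edge with an odd index is inserted, both of its ends already have an edge. -/
lemma one_le_degree_pathSequence [Finite V] (hx : Set.InjOn x (Set.Iic m)) (hm : 3 ≤ m)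
    (h1 : (m + 1) / 2 ≤ t) (h2 : t < (m + 1) / 2 + (m - 1) / 2) :
    1 ≤ ((forestAt (pathSequence m x) t).neighborSet (pathSequence m x t).1).ncard ∧
      1 ≤ ((forestAt (pathSequence m x) t).neighborSet (pathSequence m x t).2).ncard := by
  have hadj : ∀ i < (m + 1) / 2, i < m →
      (forestAt (pathSequence m x) t).Adj (x (2 * i)) (x (2 * i + 1)) := by
    intro i hi him
    refine (forestAt_adj _ _ _ _).2 ⟨fun h => ?_, i, by omega, ?_⟩
    · have := hx (by simp only [Set.mem_Iic]; omega) (by simp only [Set.mem_Iic]; omega) h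
      omega
    · simp [pathSequence, pathOrder, hi]
  have hp : pathOrder m t = 2 * (t - (m + 1) / 2) + 1 := by
    unfold pathOrder
    rw [if_neg (by omega)]
  constructor
  · refine Set.ncard_pos (Set.toFinite _) |>.2 ⟨x (2 * (t - (m + 1) / 2)), ?_⟩
    simp only [pathSequence, hp]
    exact (hadj (t - (m + 1) / 2) (by omega) (by omega)).symm
  · refine Set.ncard_pos (Set.toFinite _) |>.2 ⟨x (2 * (t - (m + 1) / 2 + 1) + 1), ?_⟩
    simp only [pathSequence, hp]
    exact hadj (t - (m + 1) / 2 + 1) (by omega) (by omega)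

lemma le_expectedAmortizedRecourse_pathSequence [Fintype V] {Δ : ℕ} (hΔ : 2 ≤ Δ) (hκ : Δ ≤ κ)
    (hκ' : κ ≤ 2 * Δ) (hx : Set.InjOn x (Set.Iic m)) (hm : 3 ≤ m) (tie : ℕ → Bool) :
    ENNReal.ofReal (1 / 8 / Δ) ≤ expectedAmortizedRecourse Δ κ (pathSequence m x) tie m := by
  have he := isInsertionSequence_pathSequence hΔ hx
  set e := pathSequence m x with hedef
  rw [expectedAmortizedRecourse_eq he hκ, ENNReal.le_div_iff_mul_le (by left; simp; omega)
    (by left; simp), ← ENNReal.ofReal_natCast, ← ENNReal.ofReal_mul (by positivity)]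
  refine ENNReal.ofReal_le_ofReal ?_
  have hκ0 : (0 : ℝ) < κ := by exact_mod_cast (by omega : 0 < κ)
  have hΔ0 : (0 : ℝ) < Δ := by exact_mod_cast (by omega : 0 < Δ)
  calc 1 / 8 / (Δ : ℝ) * m = (m : ℝ) / 4 * (1 / (2 * Δ)) := by ring
    _ ≤ (((m - 1) / 2 : ℕ) : ℝ) * (1 / κ) := by
        have h1 : (m : ℝ) ≤ 4 * ((m - 1) / 2 : ℕ) := by
          exact_mod_cast (by omega : m ≤ 4 * ((m - 1) / 2))
        have h2 : (κ : ℝ) ≤ 2 * Δ := by exact_mod_cast hκ'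
        gcongr
        linarith
    _ = ∑ i ∈ Finset.Ico ((m + 1) / 2) ((m + 1) / 2 + (m - 1) / 2), 1 / (κ : ℝ) := by
        simp
    _ ≤ ∑ i ∈ Finset.Ico ((m + 1) / 2) ((m + 1) / 2 + (m - 1) / 2),
        insertionCost κ (forestAt e i) (parentAt Δ e tie i) (childAt Δ e tie i) := by
        refine Finset.sum_le_sum fun i hi => ?_
        obtain ⟨hi1, hi2⟩ := Finset.mem_Ico.1 hi
        have him : i < m := by omega
        refine le_trans ?_ (le_insertionCost (not_reachable_parentAt_childAt he him)
          ((degree_parentAt_lt he him).trans_le hκ) ((degree_childAt_lt he him).trans_le hκ)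
          (expect_coloringLaw_eq (tie := tie) he hκ him.le).1)
        gcongr
        obtain ⟨h1, h2⟩ := one_le_degree_pathSequence hx hm hi1 hi2
        rcases parentAt_childAt_eq_or (Δ := Δ) (e := e) (tie := tie) (t := i) with h | h
        · rw [h.2]
          exact_mod_cast h2
        · rw [h.2]
          exact_mod_cast h1
    _ ≤ _ := by
        refine Finset.sum_le_sum_of_subset_of_nonneg ?_ fun _ _ _ => insertionCost_nonneg _ _ _ _
        intro i hi
        rw [Finset.mem_Ico] at hi
        rw [Finset.mem_range]
        omega

lemma exists_injOn_Iic [Fintype V] (h : m < Fintype.card V) :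
    ∃ x : ℕ → V, Set.InjOn x (Set.Iic m) := by
  have h0 : 0 < Fintype.card V := by omega
  refine ⟨fun i => (Fintype.equivFin V).symm ⟨i % Fintype.card V, Nat.mod_lt _ h0⟩, ?_⟩
  intro i hi j hj hij
  have := (Fintype.equivFin V).symm.injective hij
  simp only [Set.mem_Iic] at hi hj
  rwa [Fin.mk.injEq, Nat.mod_eq_of_lt (by omega), Nat.mod_eq_of_lt (by omega)] at this

end LowerBound

end DistMaint

theorem mainTheorem6 :
    ∃ C₁ C₂ : ℝ, 0 < C₁ ∧ 0 < C₂ ∧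
      ∀ (Δ c : ℕ), 3 ≤ Δ → c ≤ Δ - 2 →
        ∀ (V : Type*) [Fintype V],
          -- uniformity and the upper bound, for all sequences and all ways to break ties
          (∀ (e : ℕ → V × V) (m : ℕ), DistMaint.IsInsertionSequence Δ e m →
            ∀ tie : ℕ → Bool,
              (∀ t ≤ m, ∀ C : DistMaint.Coloring V (Δ + c),
                (DistMaint.IsProperEdgeColoring (DistMaint.forestAt e t) C →
                  DistMaint.coloringLaw Δ (Δ + c) e tie t C =
                    ({C' : DistMaint.Coloring V (Δ + c) |
                      DistMaint.IsProperEdgeColoring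
                        (DistMaint.forestAt e t) C'}.ncard : ℝ≥0∞)⁻¹) ∧
                (¬ DistMaint.IsProperEdgeColoring (DistMaint.forestAt e t) C →
                  DistMaint.coloringLaw Δ (Δ + c) e tie t C = 0)) ∧
              DistMaint.expectedAmortizedRecourse Δ (Δ + c) e tie m ≤
                ENNReal.ofReal (C₂ / Δ)) ∧
          -- the lower bound, for sequences of every possible length `m ≥ 3`
          (∀ m : ℕ, 3 ≤ m → m < Fintype.card V →
            ∃ e : ℕ → V × V, DistMaint.IsInsertionSequence Δ e m ∧
              ∀ tie : ℕ → Bool,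
                ENNReal.ofReal (C₁ / Δ) ≤
                  DistMaint.expectedAmortizedRecourse Δ (Δ + c) e tie m) := by
  refine ⟨1 / 8, 11, by norm_num, by norm_num, fun Δ c hΔ hc V _ => ⟨?_, ?_⟩⟩
  · intro e m he tie
    exact ⟨fun t ht C => DistMaint.coloringLaw_apply he (Nat.le_add_right Δ c) ht C,
      DistMaint.expectedAmortizedRecourse_le he hΔ (Nat.le_add_right Δ c)⟩
  · intro m hm hmV
    obtain ⟨x, hx⟩ := DistMaint.exists_injOn_Iic hmV
    exact ⟨DistMaint.pathSequence m x, DistMaint.isInsertionSequence_pathSequence (by omega) hx,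
      fun tie => DistMaint.le_expectedAmortizedRecourse_pathSequence (by omega)
        (Nat.le_add_right Δ c) (by omega) hx hm tie⟩
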